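/- \textbf{Claim (special case for isotropic spectral densities).} Let $d\ge 1$ be an integer and let $t_0>0$, $\sigma>0$. A \emph{spectral density} on $\mathbb R^d$ is a nonnegative, even, integrable function $f$. Let $C_{|k|}$ and $\tilde C_{|k|}$ be two isotropic spectral densities on $\mathbb R^d$ with finite second moments and the same total mass $\int_{\mathbb R^d} C_{|k|}\,dk=\int_{\mathbb R^d}\tilde C_{|k|}\,dk=\sigma^2$. Define $$F(r)=\frac{2\pi^{d/2}}{\sigma^2\Gamma(d/2)}\int_0^r\xi^{d-1}C_\xi\,d\xi,\qquad \tilde F(r)=\frac{2\pi^{d/2}}{\sigma^2\Gamma(d/2)}\int_0^r\xi^{d-1}\tilde C_\xi\,d\xi,$$ let $\tilde F^{-1}(u)=\inf\{r\ge 0:\ u\le\tilde F(r)\}$ be the quantile function of $\tilde F$, and set $$\eta_k=\frac1{t_0}\Big(\tilde F^{-1}\circ F(|k|)\,\frac{k}{|k|}-k\Big),\qquad T_t(k)=k+t\,\eta_k,\qquad \lambda^{(t)}=T_t\,\sharp\,(C_{|k|}\,dk),\quad t\in[0,t_0],$$ where $\sharp$ denotes push-forward of measures. (The value $0$ is given to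 $k/|k|$ at $k=0$, and to $\tilde F^{-1}(u)$ where the set $\{r\ge 0: u\le\tilde F(r)\}$ is empty; this affects $\eta$ only on a $C_{|k|}dk$-null set.) Then $\eta$ is measurable, odd ($\eta_{-k}=-\eta_k$) and square integrable with respect to $C_{|k|}\,dk$, and: \begin{enumerate} \item $\lambda^{(0)}=C_{|k|}\,dk$ and $\lambda^{(t_0)}=\tilde C_{|k|}\,dk$. \item For every $t\in[0,t_0]$ the measure $\lambda^{(t)}$ is locally attainable, i.e. it belongs to $\mathscr C^{C,\eta}=\{(k+A^{T}\eta_k)\,\sharp\,(C_{|k|}\,dk):\ A\in\mathbb R^{d\times d}\}$, and it is of the form $C^{(t)}_k\,dk$ for a spectral density $C^{(t)}$ with total mass $\sigma^2$ and finite second moment. \item $\{\lambda^{(t)}:t\in[0,t_0]\}$ is an $L_2$-Wasserstein geodesic: $W_2(\lambda^{(0)},\lambda^{(t_0)})<\infty$ and $W_2(\lambda^{(s)},\lambda^{(t)})=\frac{|t-s|}{t_0}W_2(\lambda^{(0)},\lambda^{(t_0)})$ for all $s,t\in[0,t_0]$, where $W_2(\mu,\nu)^2$ is the infimum of $\int|x-y|^2\,dp(x,y)$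 over all measures $p$ on $\mathbb R^d\times\mathbb R^d$ with marginals $\mu$ and $\nu$. \item For every $t\in[0,t_0]$ the map $T_t$ is the optimal transport from $\lambda^{(0)}$ to $\lambda^{(t)}$ for the cost $|x-y|^2$: it pushes $\lambda^{(0)}$ forward to $\lambda^{(t)}$, its cost is minimal among all transport plans, and every other optimal transport map agrees with it $\lambda^{(0)}$-almost everywhere. \item The densities $C^{(t)}$ weakly satisfy $\partial_t C^{(t)}_k+\operatorname{div}\big(\eta^{(t)}_kC^{(t)}_k\big)=0$ for all $t\in[0,t_0]$, where $\eta^{(t)}=\eta\circ T_t^{-1}$. That is, for every $t\in[0,t_0]$ there is a measurable map $T_t^{-1}$ with $T_t^{-1}(T_t(k))=k$ for $C_{|k|}dk$-almost every $k$, and for every smooth compactly supported $\varphi:\mathbb R^d\to\mathbb R$ the function $t\mapsto\int\varphi\,d\lambda^{(t)}$ is differentiable on $[0,t_0]$ (one-sidedly at the endpoints) with derivative $\int\nabla\varphi\cdot\eta^{(t)}\,d\lambda^{(t)}$, the integrand being $\lambda^{(t)}$-integrable. \end{enumerate} -/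

import Mathlib

open MeasureTheory
open scoped ENNReal ContDiff

noncomputable section

/-- Euclidean space `ℝ^d`. -/
abbrev Freq (d : ℕ) : Type := EuclideanSpace ℝ (Fin d)

/-! ### Optimal transport for the quadratic cost -/

section Transport

variable {E : Type*} [NormedAddCommGroup E] [MeasurableSpace E]

/-- `p` is a transport plan (coupling) between `μ` and `ν`. -/
def IsCoupling (μ ν : Measure E) (p : Measure (E × E)) : Prop :=
  p.fst = μ ∧ p.snd = ν

/-- The quadratic cost of a transport plan. -/
def planCost (p : Measure (E × E)) : ℝ≥0∞ :=
  ∫⁻ z, ‖z.1 - z.2‖ₑ ^ 2 ∂p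

/-- The `L²`-Wasserstein distance; the two measures need not be normalised to mass one. -/
def W2 (μ ν : Measure E) : ℝ≥0∞ :=
  (⨅ (p : Measure (E × E)) (_ : IsCoupling μ ν p), planCost p) ^ (1 / 2 : ℝ)

/-- `T` is an optimal transport from `μ` to `ν` for the quadratic cost: it pushes `μ` forward to
`ν`, and no transport plan between `μ` and `ν` is cheaper. -/
structure IsOptimalTransport (μ ν : Measure E) (T : E → E) : Prop where
  aemeasurable : AEMeasurable T μ
  map_eq : μ.map T = ν
  le_cost : ∀ p : Measure (E × E), IsCoupling μ ν p →
    ∫⁻ x, ‖x - T x‖ₑ ^ 2 ∂μ ≤ planCost p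

/-- `T` is the optimal transport from `μ` to `ν`: it is optimal, and every optimal transport
agrees with it `μ`-almost everywhere. -/
def IsTheOptimalTransport (μ ν : Measure E) (T : E → E) : Prop :=
  IsOptimalTransport μ ν T ∧ ∀ S : E → E, IsOptimalTransport μ ν S → S =ᵐ[μ] T

/-- The path `γ`, with parameter in `[0, t₀]`, is a (minimising, constant speed) geodesic for the
`L²`-Wasserstein distance. -/
def IsW2Geodesic (t₀ : ℝ) (γ : ℝ → Measure E) : Prop :=
  W2 (γ 0) (γ t₀) ≠ ⊤ ∧
  ∀ s ∈ Set.Icc 0 t₀, ∀ t ∈ Set.Icc 0 t₀,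
    W2 (γ s) (γ t) = ENNReal.ofReal (|t - s| / t₀) * W2 (γ 0) (γ t₀)

end Transport

/-! ### Spectral densities and locally attainable spectral measures -/

variable {d : ℕ}

/-- A spectral density on `ℝ^d`: a nonnegative, even, integrable function. -/
structure IsSpectralDensity (f : Freq d → ℝ) : Prop where
  nonneg : ∀ k, 0 ≤ f k
  even : ∀ k, f (-k) = f k
  integrable : Integrable f

/-- The measure `f(k) dk`. -/
def spectralMeasure (f : Freq d → ℝ) : Measure (Freq d) :=
  volume.withDensity fun k => ENNReal.ofReal (f k)

/-- A spectral density with total mass `m` and finite second moment. -/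
structure IsSpectralDensityOfMass (m : ℝ) (f : Freq d → ℝ) : Prop extends
    IsSpectralDensity f where
  mass : ∫ k, f k = m
  second_moment : Integrable fun k => ‖k‖ ^ 2 * f k

/-- The data `(f, η)` of a nonstationary spectral phase random field: a spectral density and an
odd (measurable) vector field. -/
structure IsSpectralPhaseData (f : Freq d → ℝ) (η : Freq d → Freq d) : Prop where
  density : IsSpectralDensity f
  measurable : Measurable η
  odd : ∀ k, η (-k) = -η k

/-- The family of locally attainable spectral measures, `(k + Aᵀ η_k) ♯ f` with `A` any real
`d × d` matrix. -/
def locallyAttainable (f : Freq d → ℝ) (η : Freq d → Freq d) : Set (Measure (Freq d)) :=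
  {m | ∃ A : Matrix (Fin d) (Fin d) ℝ,
    m = (spectralMeasure f).map fun k => k + Matrix.toEuclideanLin A.transpose (η k)}

/-- The map `T_t(k) = k + t η_k`. -/
def flowMap (η : Freq d → Freq d) (t : ℝ) (k : Freq d) : Freq d := k + t • η k

/-- The curve of measures `(k + t η_k) ♯ f`. -/
def spectralCurve (f : Freq d → ℝ) (η : Freq d → Freq d) (t : ℝ) : Measure (Freq d) :=
  (spectralMeasure f).map (flowMap η t)

/-- The family of measures `γ t`, `t ∈ [0, t₀]`, solves `∂ₜ γ + div (v γ) = 0` weakly (tested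
against smooth compactly supported functions), at every `t ∈ [0, t₀]`. -/
def SolvesContinuityEq (t₀ : ℝ) (γ : ℝ → Measure (Freq d)) (v : ℝ → Freq d → Freq d) : Prop :=
  ∀ φ : Freq d → ℝ, ContDiff ℝ ∞ φ → HasCompactSupport φ → ∀ t ∈ Set.Icc 0 t₀,
    Integrable (fun k => inner ℝ (gradient φ k) (v t k)) (γ t) ∧
    HasDerivWithinAt (fun s => ∫ k, φ k ∂(γ s))
      (∫ k, inner ℝ (gradient φ k) (v t k) ∂(γ t)) (Set.Icc 0 t₀) t

/-! ### The isotropic case -/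

/-- The function `k ↦ C_{|k|}` on `ℝ^d` with radial profile `C`. -/
def isotropic (d : ℕ) (C : ℝ → ℝ) : Freq d → ℝ := fun k => C ‖k‖

/-- The radial distribution function
`F(r) = 2 π^{d/2} / (σ² Γ(d/2)) * ∫₀^r ξ^{d-1} C_ξ dξ`. -/
def radialCDF (d : ℕ) (σ : ℝ) (C : ℝ → ℝ) (r : ℝ) : ℝ :=
  2 * Real.pi ^ ((d : ℝ) / 2) / (σ ^ 2 * Real.Gamma ((d : ℝ) / 2)) *
    ∫ ξ in (0 : ℝ)..r, ξ ^ (d - 1) * C ξ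

/-- The quantile function of a distribution function on `[0, ∞)`. It is the inverse function
where `F` is invertible. -/
def quantile (F : ℝ → ℝ) (u : ℝ) : ℝ := sInf {r : ℝ | 0 ≤ r ∧ u ≤ F r}

/-- The vector field `η_k = (1/t₀) (F̃⁻¹(F(|k|)) k/|k| - k)`. -/
def isotropicField (d : ℕ) (t₀ σ : ℝ) (C C' : ℝ → ℝ) (k : Freq d) : Freq d :=
  (1 / t₀) •
    (quantile (radialCDF d σ C') (radialCDF d σ C ‖k‖) • ((1 / ‖k‖) • k) - k)

end

/-!
The theorem reduces to dimension one, since `C_{|k|} dk` and `C̃_{|k|} dk` are isotropic: in polar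
coordinates (`lintegral_isotropic`) the direction of a frequency is uniformly distributed and
independent of its modulus. The map `T_t(k) = k + t η_k` keeps the direction and changes the
modulus `r` to `g_t(r) = r + (t / t₀) (q(r) - r)`, where `q = F̃⁻¹ ∘ F` (`flowMap_eq_radialMap`).

The function `radialCDF` is the distribution function of the modulus (`radialCDF_eq_cdf_normLaw`),
and it is continuous because spheres are null sets. Hence `q` is the monotone rearrangement of one
modulus law into the other (`map_rearrangement`), which gives the endpoint `λ^(t₀) = C̃ dk`
(`map_radialMap_isotropic`). Off a null set of radii `q` is positive and strictly increasing
(`ae_mem_regularRadii`, `strictMonoOn_rearrangement`), and so is `g_t` for every `t`. This makes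
`T_t` injective on a conull set, which yields the measurable inverse
(`exists_measurable_ae_leftInverse`). For `t < t₀` the map `T_t` also expands distances by at least
`1 - t / t₀` (`mul_norm_sub_le_norm_radialMap_sub`), so `λ^(t)` is absolutely continuous.

Optimality needs no convex potentials. For any coupling, `|x - y|² ≥ |x|² + |y|² - 2 |x| |y|`, with
equality when `x` and `y` have the same direction. By the layer-cake formula `∫ |x| |y|` is the
integral over `u, v > 0` of the joint tail `P(|x| > u, |y| > v)`, which is largest, for given
marginals, when `|x|` and `|y|` are comonotone (`AEComonotone.lintegral_mul_le`). The pair `(T_s,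
T_t)` has both properties, so it is an optimal coupling of `λ^(s)` and `λ^(t)`
(`lintegral_enorm_sub_sq_le_planCost`); since `T_s - T_t = (s - t) η`, the curve is a geodesic. For
a second optimal map `S` both inequalities must be equalities: the second one determines the joint
law of `(|x|, |S x|)`, hence `|S x|` (`ae_eq_comp_of_lintegral_mul_le`), and the first one the
direction of `S x` (`isTheOptimalTransport_of_comonotone`).

The continuity equation is differentiation under the integral sign along the straight trajectories
`t ↦ k + t η_k` (`solvesContinuityEq_spectralCurve`).
-/

/-! ### Polar coordinates for isotropic densities -/

/-- Integration in polar coordinates. -/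
theorem lintegral_eq_lintegral_toSphere {E : Type*} [NormedAddCommGroup E] [NormedSpace ℝ E]
    [MeasurableSpace E] [BorelSpace E] [FiniteDimensional ℝ E] [Nontrivial E]
    (vol : Measure E) [vol.IsAddHaarMeasure] {g : E → ℝ≥0∞} (hg : AEMeasurable g vol) :
    ∫⁻ x, g x ∂vol = ∫⁻ s, ∫⁻ r, g ((r : ℝ) • (s : E))
      ∂(Measure.volumeIoiPow (Module.finrank ℝ E - 1)) ∂vol.toSphere := by
  have hmp := vol.measurePreserving_homeomorphUnitSphereProd
  have hsymm := (hmp.symm (homeomorphUnitSphereProd E).toMeasurableEquiv)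
  have hsub : MeasurableEmbedding (Subtype.val : ({0}ᶜ : Set E) → E) :=
    MeasurableEmbedding.subtype_coe (measurableSet_singleton _).compl
  calc
    ∫⁻ x, g x ∂vol = ∫⁻ x : ({(0)}ᶜ : Set E), g x ∂(vol.comap (↑)) := by
      rw [lintegral_subtype_comap (measurableSet_singleton _).compl, restrict_compl_singleton]
    _ = ∫⁻ p, g ((p.2 : ℝ) • (p.1 : E))
          ∂vol.toSphere.prod (Measure.volumeIoiPow (Module.finrank ℝ E - 1)) := by
      rw [← hsymm.lintegral_comp_emb (MeasurableEquiv.measurableEmbedding _)]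
      rfl
    _ = _ := by
      refine lintegral_prod _ ?_
      have h1 : AEMeasurable (fun x : ({(0)}ᶜ : Set E) => g x) (vol.comap (↑)) := by
        have h2 : AEMeasurable g ((vol.comap (Subtype.val : ({0}ᶜ : Set E) → E)).map
            Subtype.val) := by
          rw [hsub.map_comap]
          exact hg.restrict
        exact h2.comp_measurable measurable_subtype_coe
      exact h1.comp_quasiMeasurePreserving hsymm.quasiMeasurePreserving

/-- Averaging over the unit sphere: the measure with an isotropic density is invariant under
replacing the direction of a frequency by an independent uniformly distributed one. -/
theorem lintegral_isotropic {d : ℕ} [Nontrivial (Freq d)] {C : ℝ → ℝ}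
    (hC : AEMeasurable (isotropic d C) volume) {h : Freq d → ℝ≥0∞} (hh : Measurable h) :
    (volume : Measure (Freq d)).toSphere Set.univ * ∫⁻ k, h k ∂spectralMeasure (isotropic d C) =
      ∫⁻ s, ∫⁻ k, h (‖k‖ • (s : Freq d)) ∂spectralMeasure (isotropic d C)
        ∂(volume : Measure (Freq d)).toSphere := by
  have hCm : AEMeasurable (fun k : Freq d => ENNReal.ofReal (isotropic d C k)) volume :=
    hC.ennreal_ofReal
  have key : ∀ (h : Freq d → ℝ≥0∞), Measurable h →
      ∫⁻ k, h k ∂spectralMeasure (isotropic d C) =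
      ∫⁻ s, ∫⁻ r, ENNReal.ofReal (C (r : ℝ)) * h ((r : ℝ) • (s : Freq d))
        ∂(Measure.volumeIoiPow (Module.finrank ℝ (Freq d) - 1))
        ∂(volume : Measure (Freq d)).toSphere := by
    intro h hh
    rw [spectralMeasure, lintegral_withDensity_eq_lintegral_mul₀ hCm hh.aemeasurable,
      lintegral_eq_lintegral_toSphere volume (hCm.mul hh.aemeasurable)]
    refine lintegral_congr fun s => lintegral_congr fun r => ?_
    have : ‖(r : ℝ) • (s : Freq d)‖ = r := by
      rw [norm_smul, norm_eq_of_mem_sphere, mul_one, Real.norm_of_nonneg r.2.out.le]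
    simp only [Pi.mul_apply, isotropic, this]
  have key2 : ∀ s : Metric.sphere (0 : Freq d) 1,
      ∫⁻ k, h (‖k‖ • (s : Freq d)) ∂spectralMeasure (isotropic d C) =
      (volume : Measure (Freq d)).toSphere Set.univ *
      ∫⁻ r, ENNReal.ofReal (C (r : ℝ)) * h ((r : ℝ) • (s : Freq d))
        ∂(Measure.volumeIoiPow (Module.finrank ℝ (Freq d) - 1)) := by
    intro s
    rw [key (fun k => h (‖k‖ • (s : Freq d))) (by fun_prop)]
    have : ∀ (s' : Metric.sphere (0 : Freq d) 1) (r : Set.Ioi (0 : ℝ)),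
        ‖(r : ℝ) • (s' : Freq d)‖ = r := fun s' r => by
      rw [norm_smul, norm_eq_of_mem_sphere, mul_one, Real.norm_of_nonneg r.2.out.le]
    simp only [this, lintegral_const, mul_comm]
  simp only [key2]
  rw [lintegral_const_mul' _ _ (measure_ne_top _ _), ← key h hh]

/-- The constant in front of `radialCDF` is the surface area of the unit sphere. -/
theorem radialCDF_eq_measureReal_closedBall {d : ℕ} [Nontrivial (Freq d)] (hd : 1 ≤ d) (σ : ℝ)
    {C : ℝ → ℝ} (hC : IsSpectralDensity (isotropic d C)) {r : ℝ} (hr : 0 ≤ r) :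
    radialCDF d σ C r =
      (σ ^ 2)⁻¹ * (spectralMeasure (isotropic d C)).real (Metric.closedBall 0 r) := by
  have hdpos : (0 : ℝ) < d := by exact_mod_cast hd
  have h1 : (spectralMeasure (isotropic d C)).real (Metric.closedBall 0 r) =
      ∫ k in Metric.closedBall (0 : Freq d) r, isotropic d C k := by
    rw [measureReal_def, spectralMeasure, withDensity_apply _ measurableSet_closedBall,
      integral_eq_lintegral_of_nonneg_ae (Filter.Eventually.of_forall hC.nonneg)
        hC.integrable.aestronglyMeasurable.restrict]
  have h2 : ∫ k in Metric.closedBall (0 : Freq d) r, isotropic d C k =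
      ∫ k : Freq d, (Set.Iic r).indicator C ‖k‖ := by
    rw [← integral_indicator measurableSet_closedBall]
    refine integral_congr_ae (Filter.Eventually.of_forall fun k => ?_)
    simp [Set.indicator, isotropic]
  have h3 : ∫ y in Set.Ioi (0 : ℝ), y ^ (d - 1) • (Set.Iic r).indicator C y =
      ∫ ξ in (0 : ℝ)..r, ξ ^ (d - 1) * C ξ := by
    rw [intervalIntegral.integral_of_le hr, ← Set.Ioi_inter_Iic,
      ← setIntegral_indicator measurableSet_Iic]
    refine integral_congr_ae (Filter.Eventually.of_forall fun y => ?_)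
    by_cases hy : y ≤ r <;> simp [Set.indicator, hy]
  have h4 : (volume : Measure (Freq d)).real (Metric.ball 0 1) =
      Real.pi ^ ((d : ℝ) / 2) / Real.Gamma ((d : ℝ) / 2 + 1) := by
    have : Nonempty (Fin d) := ⟨⟨0, hd⟩⟩
    rw [measureReal_def, EuclideanSpace.volume_ball]
    simp only [Fintype.card_fin, ENNReal.ofReal_one, one_pow, one_mul]
    rw [ENNReal.toReal_ofReal (by positivity), Real.sqrt_eq_rpow, ← Real.rpow_natCast,
      ← Real.rpow_mul Real.pi_pos.le]
    congr 2
    ring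
  rw [h1, h2, integral_fun_norm_addHaar, h4, finrank_euclideanSpace_fin, h3, radialCDF,
    Real.Gamma_add_one (by positivity), nsmul_eq_mul, smul_eq_mul]
  have := Real.Gamma_pos_of_pos (show 0 < (d : ℝ) / 2 by positivity)
  field_simp

/-! ### Quantile functions and monotone rearrangement on the half-line -/

open ProbabilityTheory in
/-- The map `F_{P'}⁻¹ ∘ F_P` built from distribution functions. On the half-line it is the monotone
rearrangement of `P` into `P'` when neither measure has atoms. -/
noncomputable def rearrangement (P P' : Measure ℝ) (r : ℝ) : ℝ := quantile (cdf P') (cdf P r)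

section Quantile

open ProbabilityTheory Filter Topology

theorem quantile_congr {F G : ℝ → ℝ} (h : ∀ r, 0 ≤ r → F r = G r) : quantile F = quantile G := by
  ext u
  unfold quantile
  congr 1
  ext r
  exact and_congr_right fun hr => by rw [h r hr]

theorem quantile_nonneg (F : ℝ → ℝ) (u : ℝ) : 0 ≤ quantile F u :=
  Real.sInf_nonneg fun _ hr => hr.1

variable {P P' : Measure ℝ}

theorem continuous_cdf_of_noAtoms [IsProbabilityMeasure P] [NullSingletonClass P] :
    Continuous (cdf P) := by
  refine continuous_iff_continuousAt.2 fun x => ?_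
  rw [(monotone_cdf P).continuousAt_iff_leftLim_eq_rightLim, StieltjesFunction.rightLim_eq]
  have h : (cdf P).measure {x} = 0 := by rw [measure_cdf]; exact measure_singleton x
  rw [StieltjesFunction.measure_singleton, ENNReal.ofReal_eq_zero] at h
  have := (monotone_cdf P).leftLim_le (le_refl x)
  linarith

theorem cdf_zero_of_noAtoms [IsProbabilityMeasure P] [NullSingletonClass P]
    (h0 : P (Set.Iio 0) = 0) : cdf P 0 = 0 := by
  have : P (Set.Iic 0) = 0 := by
    rw [← Set.Iio_union_right]
    exact measure_union_null h0 (measure_singleton 0)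
  rw [cdf_eq_real, measureReal_def, this, ENNReal.toReal_zero]

/-- A continuous distribution function pushes its own measure forward to the uniform
distribution. -/
theorem measure_setOf_cdf_le [IsProbabilityMeasure P] [NullSingletonClass P]
    (h0 : P (Set.Iio 0) = 0) {c : ℝ} (hc : 0 ≤ c)
    (hc1 : c < 1) : P {r | cdf P r ≤ c} = ENNReal.ofReal c := by
  have hcont := continuous_cdf_of_noAtoms (P := P)
  obtain ⟨b, hb⟩ := ((tendsto_cdf_atTop P).eventually (lt_mem_nhds hc1)).exists
  have hbdd : BddAbove {r | cdf P r ≤ c} :=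
    ⟨b, fun r hr => le_of_not_gt fun h => absurd ((monotone_cdf P) h.le)
      (not_le.2 (lt_of_le_of_lt hr hb))⟩
  have hne : {r | cdf P r ≤ c}.Nonempty := ⟨0, by
    simpa [cdf_zero_of_noAtoms h0] using hc⟩
  have hclosed : IsClosed {r | cdf P r ≤ c} := isClosed_le hcont continuous_const
  -- the sublevel set is the half-line ending at its largest element `m`, and `F(m) = c`
  set m := sSup {r | cdf P r ≤ c}
  have hmem : cdf P m ≤ c := hclosed.csSup_mem hne hbdd
  have hset : {r | cdf P r ≤ c} = Set.Iic m := by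
    ext r
    exact ⟨fun hr => le_csSup hbdd hr, fun hr => (monotone_cdf P hr).trans hmem⟩
  have heq : cdf P m = c := by
    refine le_antisymm hmem (le_of_not_gt fun hlt => ?_)
    have h1 : ∀ᶠ x in 𝓝[>] m, cdf P x < c :=
      (hcont.continuousAt.eventually_lt continuousAt_const hlt).filter_mono nhdsWithin_le_nhds
    obtain ⟨x, hx, hxm⟩ := (h1.and self_mem_nhdsWithin).exists
    exact absurd (le_csSup hbdd hx.le) (not_le.2 hxm)
  rw [hset, ← ofReal_cdf, heq]

theorem ae_cdf_lt_one [IsProbabilityMeasure P] [NullSingletonClass P]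
    (h0 : P (Set.Iio 0) = 0) : ∀ᵐ r ∂P, cdf P r < 1 := by
  have hmeas : MeasurableSet {r | cdf P r < 1} :=
    measurableSet_lt (monotone_cdf P).measurable measurable_const
  refine (prob_compl_eq_zero_iff hmeas).2 (le_antisymm prob_le_one ?_)
  have hlim : Tendsto (fun n : ℕ => ENNReal.ofReal (1 - 1 / ((n : ℝ) + 1))) atTop (𝓝 1) := by
    have := ENNReal.tendsto_ofReal
      ((tendsto_const_nhds (x := (1 : ℝ))).sub (tendsto_one_div_add_atTop_nhds_zero_nat (𝕜 := ℝ)))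
    simpa using this
  refine le_of_tendsto hlim (Eventually.of_forall fun n => ?_)
  have hn : (0 : ℝ) < 1 / ((n : ℝ) + 1) := by positivity
  have hn1 : 1 / ((n : ℝ) + 1) ≤ 1 := by
    rw [div_le_one (by positivity)]
    linarith [Nat.cast_nonneg (α := ℝ) n]
  rw [← measure_setOf_cdf_le h0 (by linarith) (by linarith : 1 - 1 / ((n : ℝ) + 1) < 1)]
  exact measure_mono fun r (hr : cdf P r ≤ _) => show cdf P r < 1 by linarith

theorem quantile_set_nonempty {u : ℝ} (hu : u < 1) : {r : ℝ | 0 ≤ r ∧ u ≤ cdf P r}.Nonempty := by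
  obtain ⟨b, hb, hb0⟩ := (((tendsto_cdf_atTop P).eventually (lt_mem_nhds hu)).and
    (eventually_ge_atTop 0)).exists
  exact ⟨b, hb0, hb.le⟩

/-- The quantile function and the distribution function form a Galois connection. -/
theorem quantile_cdf_le_iff [IsProbabilityMeasure P] [NullSingletonClass P]
    {u a : ℝ} (hu : u < 1) (ha : 0 ≤ a) :
    quantile (cdf P) u ≤ a ↔ u ≤ cdf P a := by
  have hbdd : BddBelow {r : ℝ | 0 ≤ r ∧ u ≤ cdf P r} := ⟨0, fun r hr => hr.1⟩
  constructor
  · intro h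
    have hclosed : IsClosed {r : ℝ | 0 ≤ r ∧ u ≤ cdf P r} :=
      (isClosed_le continuous_const continuous_id).inter
        (isClosed_le continuous_const continuous_cdf_of_noAtoms)
    have := hclosed.csInf_mem (quantile_set_nonempty hu) hbdd
    exact this.2.trans (monotone_cdf P h)
  · intro h
    exact csInf_le hbdd ⟨ha, h⟩

theorem cdf_quantile [IsProbabilityMeasure P] [NullSingletonClass P]
    (h0 : P (Set.Iio 0) = 0) {u : ℝ} (hu0 : 0 ≤ u) (hu : u < 1) :
    cdf P (quantile (cdf P) u) = u := by
  refine le_antisymm (le_of_not_gt fun hlt => ?_)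
    ((quantile_cdf_le_iff hu (quantile_nonneg _ _)).1 le_rfl)
  have hpos : 0 < quantile (cdf P) u := by
    refine lt_of_le_of_ne (quantile_nonneg _ _) fun h => ?_
    rw [← h, cdf_zero_of_noAtoms h0] at hlt
    linarith
  have h1 : ∀ᶠ x in 𝓝[<] quantile (cdf P) u, u < cdf P x :=
    (continuousAt_const.eventually_lt continuous_cdf_of_noAtoms.continuousAt hlt).filter_mono
      nhdsWithin_le_nhds
  have h2 : ∀ᶠ x in 𝓝[<] quantile (cdf P) u, 0 < x :=
    (lt_mem_nhds hpos).filter_mono nhdsWithin_le_nhds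
  obtain ⟨x, ⟨hx, hx0⟩, hxq⟩ := ((h1.and h2).and self_mem_nhdsWithin).exists
  exact absurd ((quantile_cdf_le_iff hu hx0.le).2 hx.le) (not_le.2 hxq)

theorem measurable_rearrangement [IsProbabilityMeasure P'] [NullSingletonClass P'] :
    Measurable (rearrangement P P') := by
  refine (?_ : Measurable (quantile (cdf P'))).comp (monotone_cdf P).measurable
  refine measurable_of_Iic fun a => ?_
  by_cases ha : 0 ≤ a
  -- the Galois connection describes the sublevel set on `u < 1`; for `u > 1` the quantile is `0`
  · have : quantile (cdf P') ⁻¹' Set.Iic a =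
        (Set.Iio 1 ∩ Set.Iic (cdf P' a)) ∪ ({1} ∩ quantile (cdf P') ⁻¹' Set.Iic a) ∪ Set.Ioi 1 := by
      ext u
      rcases lt_trichotomy u 1 with hu | rfl | hu
      · simp [quantile_cdf_le_iff hu ha, hu, hu.ne, hu.le]
      · simp
      · have : quantile (cdf P') u = 0 := by
          have : {r : ℝ | 0 ≤ r ∧ u ≤ cdf P' r} = ∅ := by
            ext r
            simpa using fun _ => (cdf_le_one P' r).trans_lt hu
          rw [quantile, this, Real.sInf_empty]
        simp [this, ha, hu]
    rw [this]
    exact ((measurableSet_Iio.inter measurableSet_Iic).union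
      ((Set.finite_singleton 1).subset Set.inter_subset_left).measurableSet).union
        measurableSet_Ioi
  · have : quantile (cdf P') ⁻¹' Set.Iic a = ∅ := by
      ext u
      simpa using (not_le.1 ha).trans_le (quantile_nonneg _ u)
    rw [this]
    exact MeasurableSet.empty

/-- The rearrangement pushes `P` forward to `P'`. -/
theorem map_rearrangement [IsProbabilityMeasure P] [NullSingletonClass P]
    [IsProbabilityMeasure P'] [NullSingletonClass P']
    (h0 : P (Set.Iio 0) = 0) (h0' : P' (Set.Iio 0) = 0) : P.map (rearrangement P P') = P' := by
  have hm : Measurable (rearrangement P P') := measurable_rearrangement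
  refine Measure.ext_of_Iic _ _ fun a => ?_
  rw [Measure.map_apply hm measurableSet_Iic]
  by_cases ha : 0 ≤ a
  · rw [← ofReal_cdf P' a]
    have h1 : P (rearrangement P P' ⁻¹' Set.Iic a) = P {r | cdf P r ≤ cdf P' a} := by
      refine measure_congr ?_
      filter_upwards [ae_cdf_lt_one h0] with r hr
      exact propext (quantile_cdf_le_iff hr ha)
    rw [h1]
    rcases (cdf_le_one P' a).lt_or_eq with h | h
    · exact measure_setOf_cdf_le h0 (cdf_nonneg P' a) h
    · have : {r | cdf P r ≤ cdf P' a} = Set.univ := by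
        ext r
        simpa [h] using cdf_le_one P r
      rw [this, h, measure_univ, ENNReal.ofReal_one]
  · have h1 : rearrangement P P' ⁻¹' Set.Iic a = ∅ :=
      Set.eq_empty_of_forall_notMem fun u hu =>
        ha ((quantile_nonneg (cdf P') (cdf P u)).trans hu)
    have h2 : P' (Set.Iic a) = 0 :=
      measure_mono_null (fun x (hx : x ≤ a) => lt_of_le_of_lt hx (not_le.1 ha)) h0'
    rw [h1, measure_empty, h2]

/-- Two functions with the same law, one of which dominates the other, agree almost everywhere. -/
theorem ae_eq_of_le_of_map_eq {Ω : Type*} [MeasurableSpace Ω] {μ : Measure Ω} [IsFiniteMeasure μ]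
    {X Y : Ω → ℝ} (hX : AEMeasurable X μ) (hY : AEMeasurable Y μ) (hle : X ≤ᵐ[μ] Y)
    (hmap : μ.map X = μ.map Y) : X =ᵐ[μ] Y := by
  -- composing with the bounded strictly increasing function `arctan` makes both sides integrable
  have hint : ∀ {Z : Ω → ℝ}, AEMeasurable Z μ → Integrable (fun x => Real.arctan (Z x)) μ := by
    intro Z hZ
    refine Integrable.of_bound (Real.measurable_arctan.comp_aemeasurable hZ).aestronglyMeasurable
      (Real.pi / 2) (Eventually.of_forall fun x => ?_)
    rw [Real.norm_eq_abs, abs_le]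
    exact ⟨(Real.neg_pi_div_two_lt_arctan _).le, (Real.arctan_lt_pi_div_two _).le⟩
  have hI : ∀ {Z : Ω → ℝ}, AEMeasurable Z μ →
      ∫ x, Real.arctan (Z x) ∂μ = ∫ x, Real.arctan x ∂(μ.map Z) := fun hZ =>
    (integral_map hZ Real.continuous_arctan.aestronglyMeasurable).symm
  have := (integral_eq_iff_of_ae_le (hint hX) (hint hY)
    (hle.mono fun x h => Real.arctan_strictMono.monotone h)).1 (by rw [hI hX, hI hY, hmap])
  exact this.mono fun x h => Real.arctan_injective h

/-- The quantile function is almost everywhere a left inverse of the distribution function: the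
composition is at most the identity and preserves the law. -/
theorem rearrangement_self_ae_eq [IsProbabilityMeasure P] [NullSingletonClass P]
    (h0 : P (Set.Iio 0) = 0) :
    ∀ᵐ r ∂P, rearrangement P P r = r := by
  refine ae_eq_of_le_of_map_eq measurable_rearrangement.aemeasurable aemeasurable_id ?_
    (by rw [map_rearrangement h0 h0]; exact Measure.map_id.symm)
  have hpos : ∀ᵐ r ∂P, 0 ≤ r := measure_mono_null (fun r (hr : ¬0 ≤ r) => not_le.1 hr) h0
  filter_upwards [ae_cdf_lt_one h0, hpos] with r hr hr0
  exact (quantile_cdf_le_iff hr hr0).2 le_rfl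

/-- A conull set of radii on which the rearrangement of `P` into `P'` is strictly increasing and
positive. The third condition says that `r` is the left end of its level set of the distribution
function of `P`, which makes that function strictly increasing on this set. -/
def regularRadii (P P' : Measure ℝ) : Set ℝ :=
  {r | 0 < r ∧ cdf P r < 1 ∧ rearrangement P P r = r ∧ 0 < rearrangement P P' r}

theorem measurableSet_regularRadii [IsProbabilityMeasure P] [NullSingletonClass P]
    [IsProbabilityMeasure P'] [NullSingletonClass P'] :
    MeasurableSet (regularRadii P P') :=
  measurableSet_Ioi.inter ((measurableSet_lt (monotone_cdf P).measurable measurable_const).inter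
    ((measurableSet_eq_fun measurable_rearrangement measurable_id).inter
      (measurableSet_lt measurable_const measurable_rearrangement)))

theorem ae_mem_regularRadii [IsProbabilityMeasure P] [NullSingletonClass P]
    [IsProbabilityMeasure P'] [NullSingletonClass P']
    (h0 : P (Set.Iio 0) = 0) (h0' : P' (Set.Iio 0) = 0) : ∀ᵐ r ∂P, r ∈ regularRadii P P' := by
  have hpos : ∀ {Q : Measure ℝ} [NullSingletonClass Q], Q (Set.Iio 0) = 0 → ∀ᵐ r ∂Q, 0 < r := by
    intro Q _ hQ
    have : Q (Set.Iic 0) = 0 := by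
      rw [← Set.Iio_union_right]
      exact measure_union_null hQ (measure_singleton 0)
    exact measure_mono_null (fun r (hr : ¬0 < r) => not_lt.1 hr) this
  have hq : ∀ᵐ r ∂P, 0 < rearrangement P P' r := by
    refine ae_of_ae_map (f := rearrangement P P') (p := fun y => 0 < y)
      measurable_rearrangement.aemeasurable ?_
    rw [map_rearrangement h0 h0']
    exact hpos h0'
  filter_upwards [hpos h0, ae_cdf_lt_one h0, rearrangement_self_ae_eq h0, hq] with r h1 h2 h3 h4
  exact ⟨h1, h2, h3, h4⟩

theorem strictMonoOn_rearrangement [IsProbabilityMeasure P'] [NullSingletonClass P']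
    (h0' : P' (Set.Iio 0) = 0) :
    StrictMonoOn (rearrangement P P') (regularRadii P P') := by
  intro r hr s hs hrs
  refine lt_of_not_ge fun hle => ?_
  have h1 : cdf P r < cdf P s := by
    refine lt_of_le_of_ne (monotone_cdf P hrs.le) fun h => hrs.ne ?_
    rw [← hr.2.2.1, ← hs.2.2.1, rearrangement, rearrangement, h]
  have h2 := monotone_cdf P' hle
  rw [rearrangement, rearrangement, cdf_quantile h0' (cdf_nonneg _ _) hr.2.1,
    cdf_quantile h0' (cdf_nonneg _ _) hs.2.1] at h2
  linarith

end Quantile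

/-! ### The Hardy–Littlewood–Hoeffding inequality for comonotone functions -/

section Comonotone

open Filter Topology Set

variable {Ω Ω' : Type*} [MeasurableSpace Ω] [MeasurableSpace Ω'] {m : Measure Ω} {p : Measure Ω'}

/-- Layer-cake formula for a product of two nonnegative functions. -/
theorem lintegral_mul_eq_lintegral_measure [SFinite m] {X Y : Ω → ℝ} (hX : AEMeasurable X m)
    (hY : AEMeasurable Y m) :
    ∫⁻ x, ENNReal.ofReal (X x) * ENNReal.ofReal (Y x) ∂m =
      ∫⁻ z in Ioi (0 : ℝ) ×ˢ Ioi (0 : ℝ), m {x | z.1 < X x ∧ z.2 < Y x} := by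
  wlog hmeas : Measurable X ∧ Measurable Y generalizing X Y
  · have h1 := this (X := hX.mk X) (Y := hY.mk Y) hX.measurable_mk.aemeasurable
      hY.measurable_mk.aemeasurable ⟨hX.measurable_mk, hY.measurable_mk⟩
    calc _ = ∫⁻ x, ENNReal.ofReal (hX.mk X x) * ENNReal.ofReal (hY.mk Y x) ∂m := by
          refine lintegral_congr_ae ?_
          filter_upwards [hX.ae_eq_mk, hY.ae_eq_mk] with x h2 h3
          rw [h2, h3]
      _ = _ := h1
      _ = _ := by
          refine lintegral_congr fun z => measure_congr ?_
          filter_upwards [hX.ae_eq_mk, hY.ae_eq_mk] with x h2 h3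
          change (_ ∧ _) = (_ ∧ _)
          rw [h2, h3]
  obtain ⟨hX, hY⟩ := hmeas
  have hS : MeasurableSet {w : Ω × (ℝ × ℝ) | w.2.1 < X w.1 ∧ w.2.2 < Y w.1} := by
    have hS₁ : MeasurableSet {w : Ω × (ℝ × ℝ) | w.2.1 < X w.1} :=
      measurableSet_lt (by fun_prop) (by fun_prop)
    have hS₂ : MeasurableSet {w : Ω × (ℝ × ℝ) | w.2.2 < Y w.1} :=
      measurableSet_lt (by fun_prop) (by fun_prop)
    exact hS₁.inter hS₂
  have hpt : ∀ x, ENNReal.ofReal (X x) * ENNReal.ofReal (Y x) =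
      ∫⁻ z in Ioi (0 : ℝ) ×ˢ Ioi (0 : ℝ),
        {w : Ω × (ℝ × ℝ) | w.2.1 < X w.1 ∧ w.2.2 < Y w.1}.indicator (fun _ => 1) (x, z) := by
    intro x
    have h1 : ∀ z : ℝ × ℝ,
        {w : Ω × (ℝ × ℝ) | w.2.1 < X w.1 ∧ w.2.2 < Y w.1}.indicator (fun _ => (1 : ℝ≥0∞)) (x, z) =
        (Iio (X x) ×ˢ Iio (Y x)).indicator 1 z := fun z => rfl
    simp only [h1]
    rw [lintegral_indicator_one (measurableSet_Iio.prod measurableSet_Iio),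
      Measure.restrict_apply (measurableSet_Iio.prod measurableSet_Iio), prod_inter_prod,
      Measure.volume_eq_prod, Measure.prod_prod, inter_comm, Ioi_inter_Iio, inter_comm,
      Ioi_inter_Iio, Real.volume_Ioo, Real.volume_Ioo, sub_zero, sub_zero]
  simp only [hpt]
  rw [lintegral_lintegral_swap (by exact (measurable_const.indicator hS).aemeasurable)]
  refine lintegral_congr fun z => ?_
  have h2 : MeasurableSet {x | z.1 < X x ∧ z.2 < Y x} :=
    (measurableSet_lt measurable_const hX).inter (measurableSet_lt measurable_const hY)
  rw [← lintegral_indicator_one h2]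
  rfl

/-- `X` and `Y` are `m`-almost surely comonotone: off a null set they are never ordered in opposite
directions. -/
def AEComonotone (m : Measure Ω) (X Y : Ω → ℝ) : Prop :=
  ∃ G : Set Ω, (∀ᵐ x ∂m, x ∈ G) ∧ ∀ x ∈ G, ∀ y ∈ G, X x < X y → Y x ≤ Y y

/-- Among all pairs with given marginal laws, a comonotone one has the largest joint upper tails,
because its upper level sets are nested. -/
theorem AEComonotone.measure_le {X Y : Ω → ℝ} {X' Y' : Ω' → ℝ} (h : AEComonotone m X Y)
    (hX : AEMeasurable X m) (hY : AEMeasurable Y m) (hX' : AEMeasurable X' p)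
    (hY' : AEMeasurable Y' p) (hXX' : p.map X' = m.map X) (hYY' : p.map Y' = m.map Y) (u v : ℝ) :
    p {x | u < X' x ∧ v < Y' x} ≤ m {x | u < X x ∧ v < Y x} := by
  obtain ⟨G, hG, hmono⟩ := h
  have hXu : p {x | u < X' x} = m {x | u < X x} := by
    have := congrArg (fun M => M (Ioi u)) hXX'
    simp only [Measure.map_apply_of_aemeasurable hX' measurableSet_Ioi,
      Measure.map_apply_of_aemeasurable hX measurableSet_Ioi] at this
    exact this
  have hYv : p {x | v < Y' x} = m {x | v < Y x} := by
    have := congrArg (fun M => M (Ioi v)) hYY'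
    simp only [Measure.map_apply_of_aemeasurable hY' measurableSet_Ioi,
      Measure.map_apply_of_aemeasurable hY measurableSet_Ioi] at this
    exact this
  -- on `G` the upper level sets of `X` and `Y` are nested one way or the other
  by_cases hsub : ∀ x ∈ G, u < X x → v < Y x
  · calc p {x | u < X' x ∧ v < Y' x} ≤ p {x | u < X' x} := measure_mono fun x hx => hx.1
      _ = m {x | u < X x} := hXu
      _ ≤ m {x | u < X x ∧ v < Y x} :=
        measure_mono_ae (by filter_upwards [hG] with x hx hu using ⟨hu, hsub x hx hu⟩)
  · push Not at hsub
    obtain ⟨x₀, hx₀, hu₀, hv₀⟩ := hsub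
    calc p {x | u < X' x ∧ v < Y' x} ≤ p {x | v < Y' x} := measure_mono fun x hx => hx.2
      _ = m {x | v < Y x} := hYv
      _ ≤ m {x | u < X x ∧ v < Y x} := measure_mono_ae (by
        filter_upwards [hG] with x hx hv
        refine ⟨lt_of_not_ge fun hle => ?_, hv⟩
        exact absurd (hmono x hx x₀ hx₀ (lt_of_le_of_lt hle hu₀))
          (not_le.2 (lt_of_le_of_lt hv₀ hv)))

/-- The rearrangement inequality: among all pairs with given marginal laws, a comonotone one
maximises the integral of the product of the positive parts. -/
theorem AEComonotone.lintegral_mul_le [SFinite m] [SFinite p] {X Y : Ω → ℝ} {X' Y' : Ω' → ℝ}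
    (h : AEComonotone m X Y) (hX : AEMeasurable X m) (hY : AEMeasurable Y m)
    (hX' : AEMeasurable X' p) (hY' : AEMeasurable Y' p) (hXX' : p.map X' = m.map X)
    (hYY' : p.map Y' = m.map Y) :
    ∫⁻ x, ENNReal.ofReal (X' x) * ENNReal.ofReal (Y' x) ∂p ≤
      ∫⁻ x, ENNReal.ofReal (X x) * ENNReal.ofReal (Y x) ∂m := by
  rw [lintegral_mul_eq_lintegral_measure hX hY, lintegral_mul_eq_lintegral_measure hX' hY']
  exact lintegral_mono fun z => h.measure_le hX hY hX' hY' hXX' hYY' z.1 z.2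

theorem measurable_measure_setOf_lt_and_lt [SFinite m] {X Y : Ω → ℝ} (hX : AEMeasurable X m)
    (hY : AEMeasurable Y m) : Measurable fun z : ℝ × ℝ => m {x | z.1 < X x ∧ z.2 < Y x} := by
  have h1 : (fun z : ℝ × ℝ => m {x | z.1 < X x ∧ z.2 < Y x}) =
      fun z : ℝ × ℝ => m {x | z.1 < hX.mk X x ∧ z.2 < hY.mk Y x} := by
    ext z
    refine measure_congr ?_
    filter_upwards [hX.ae_eq_mk, hY.ae_eq_mk] with x h2 h3
    change (_ ∧ _) = (_ ∧ _)
    rw [h2, h3]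
  have hm1 := hX.measurable_mk
  have hm2 := hY.measurable_mk
  have hS : MeasurableSet {w : (ℝ × ℝ) × Ω | w.1.1 < hX.mk X w.2 ∧ w.1.2 < hY.mk Y w.2} := by
    have hS₁ : MeasurableSet {w : (ℝ × ℝ) × Ω | w.1.1 < hX.mk X w.2} :=
      measurableSet_lt (by fun_prop) (by fun_prop)
    have hS₂ : MeasurableSet {w : (ℝ × ℝ) × Ω | w.1.2 < hY.mk Y w.2} :=
      measurableSet_lt (by fun_prop) (by fun_prop)
    exact hS₁.inter hS₂
  rw [h1]
  exact measurable_measure_prodMk_left hS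

/-- Right continuity of joint upper tails, as a criterion for upper bounds. -/
theorem measure_setOf_lt_and_lt_le_of_forall_lt {X Y : Ω → ℝ} {u v : ℝ} {c : ℝ≥0∞}
    (h : ∀ ε > 0, m {x | u + ε < X x ∧ v + ε < Y x} ≤ c) : m {x | u < X x ∧ v < Y x} ≤ c := by
  have hanti : ∀ {i j : ℕ}, i ≤ j → 1 / ((j : ℝ) + 1) ≤ 1 / ((i : ℝ) + 1) := fun hij =>
    one_div_le_one_div_of_le (by positivity) (by exact_mod_cast Nat.succ_le_succ hij)
  have hU : {x | u < X x ∧ v < Y x} =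
      ⋃ n : ℕ, {x | u + 1 / ((n : ℝ) + 1) < X x ∧ v + 1 / ((n : ℝ) + 1) < Y x} := by
    ext x
    simp only [mem_ofPred_eq, mem_iUnion]
    constructor
    · rintro ⟨h1, h2⟩
      obtain ⟨n, hn⟩ := exists_nat_one_div_lt (lt_min (sub_pos.2 h1) (sub_pos.2 h2))
      exact ⟨n, by linarith [hn.trans_le (min_le_left _ _)],
        by linarith [hn.trans_le (min_le_right _ _)]⟩
    · rintro ⟨n, h1, h2⟩
      have : 0 < 1 / ((n : ℝ) + 1) := by positivity
      exact ⟨by linarith, by linarith⟩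
  rw [hU, Monotone.measure_iUnion]
  · exact iSup_le fun n => h _ (by positivity)
  · intro i j hij x hx
    have := hanti hij
    exact ⟨by linarith [hx.1], by linarith [hx.2]⟩

/-- Equality case of `AEComonotone.lintegral_mul_le`: the joint upper tails agree at almost every,
hence by right continuity at every, pair of nonnegative levels. -/
theorem AEComonotone.measure_eq_of_lintegral_le [IsFiniteMeasure m] [IsFiniteMeasure p]
    {X Y : Ω → ℝ} {X' Y' : Ω' → ℝ}
    (h : AEComonotone m X Y) (hX : AEMeasurable X m) (hY : AEMeasurable Y m)
    (hX' : AEMeasurable X' p) (hY' : AEMeasurable Y' p) (hXX' : p.map X' = m.map X)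
    (hYY' : p.map Y' = m.map Y)
    (hfin : ∫⁻ x, ENNReal.ofReal (X x) * ENNReal.ofReal (Y x) ∂m ≠ ⊤)
    (hle : ∫⁻ x, ENNReal.ofReal (X x) * ENNReal.ofReal (Y x) ∂m ≤
      ∫⁻ x, ENNReal.ofReal (X' x) * ENNReal.ofReal (Y' x) ∂p) {u v : ℝ} (hu : 0 ≤ u) (hv : 0 ≤ v) :
    p {x | u < X' x ∧ v < Y' x} = m {x | u < X x ∧ v < Y x} := by
  have hle' := h.measure_le hX hY hX' hY' hXX' hYY'
  rw [lintegral_mul_eq_lintegral_measure hX hY] at hle hfin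
  rw [lintegral_mul_eq_lintegral_measure hX' hY'] at hle
  have hae : (fun z : ℝ × ℝ => p {x | z.1 < X' x ∧ z.2 < Y' x})
      =ᵐ[volume.restrict (Ioi (0 : ℝ) ×ˢ Ioi (0 : ℝ))]
      fun z : ℝ × ℝ => m {x | z.1 < X x ∧ z.2 < Y x} :=
    ae_eq_of_ae_le_of_lintegral_le (Eventually.of_forall fun z => hle' z.1 z.2)
      (ne_top_of_le_ne_top hfin (lintegral_mono fun z => hle' z.1 z.2))
      (measurable_measure_setOf_lt_and_lt hX hY).aemeasurable hle
  refine le_antisymm (hle' u v) (measure_setOf_lt_and_lt_le_of_forall_lt fun ε hε => ?_)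
  have hbox : (volume.restrict (Ioi (0 : ℝ) ×ˢ Ioi (0 : ℝ)))
      (Ioo u (u + ε) ×ˢ Ioo v (v + ε)) ≠ 0 := by
    rw [Measure.restrict_apply (measurableSet_Ioo.prod measurableSet_Ioo),
      inter_eq_left.2 (prod_mono (Ioo_subset_Ioi_self.trans (Ioi_subset_Ioi hu))
        (Ioo_subset_Ioi_self.trans (Ioi_subset_Ioi hv))), Measure.volume_eq_prod, Measure.prod_prod,
      Real.volume_Ioo, Real.volume_Ioo]
    simp [hε]
  obtain ⟨z, hz, hzeq⟩ := ((frequently_ae_mem_iff.2 hbox).and_eventually hae).exists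
  calc m {x | u + ε < X x ∧ v + ε < Y x} ≤ m {x | z.1 < X x ∧ z.2 < Y x} :=
        measure_mono fun x hx => ⟨hz.1.2.trans hx.1, hz.2.2.trans hx.2⟩
    _ = p {x | z.1 < X' x ∧ z.2 < Y' x} := hzeq.symm
    _ ≤ p {x | u < X' x ∧ v < Y' x} :=
        measure_mono fun x hx => ⟨hz.1.1.trans hx.1, hz.2.1.trans hx.2⟩

/-- Uniqueness of the monotone rearrangement: if `Z` has the law of `g ∘ N` with `g` monotone and
correlates with `N` at least as much as `g ∘ N` does, then `Z = g ∘ N`. The equality case above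
identifies the joint law of `(N, Z)`, which is therefore carried by the graph of `g`. -/
theorem ae_eq_comp_of_lintegral_mul_le [IsFiniteMeasure m] {N Z : Ω → ℝ} {g : ℝ → ℝ}
    (hN : AEMeasurable N m) (hZ : AEMeasurable Z m) (hg : Measurable g)
    (h : AEComonotone m N (g ∘ N)) (hN0 : ∀ x, 0 ≤ N x) (hZ0 : ∀ x, 0 ≤ Z x)
    (hmap : m.map Z = m.map (g ∘ N))
    (hfin : ∫⁻ x, ENNReal.ofReal (N x) * ENNReal.ofReal (g (N x)) ∂m ≠ ⊤)
    (hle : ∫⁻ x, ENNReal.ofReal (N x) * ENNReal.ofReal (g (N x)) ∂m ≤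
      ∫⁻ x, ENNReal.ofReal (N x) * ENNReal.ofReal (Z x) ∂m) : Z =ᵐ[m] g ∘ N := by
  have hgN : AEMeasurable (fun x => g (N x)) m := hg.comp_aemeasurable hN
  change m.map Z = m.map (fun x => g (N x)) at hmap
  have hg0 : ∀ᵐ x ∂m, 0 ≤ g (N x) := by
    have h1 : ∀ᵐ y ∂(m.map Z), 0 ≤ y :=
      (ae_map_iff hZ measurableSet_Ici).2 (Eventually.of_forall hZ0)
    rw [hmap] at h1
    exact ae_of_ae_map hgN h1
  have hpos := fun u v => h.measure_eq_of_lintegral_le hN hgN hN hZ rfl hmap hfin hle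
    (u := u) (v := v)
  -- negative levels impose no condition on nonnegative functions
  have hall : ∀ u v : ℝ, m {x | u < N x ∧ v < Z x} = m {x | u < N x ∧ v < g (N x)} := by
    intro u v
    rcases lt_or_ge v 0 with hv | hv
    · refine measure_congr ?_
      filter_upwards [hg0] with x hx
      change (_ ∧ _) = (_ ∧ _)
      simp [hv.trans_le hx, hv.trans_le (hZ0 x)]
    rcases lt_or_ge u 0 with hu | hu
    · have h1 : ∀ W : Ω → ℝ, {x | u < N x ∧ v < W x} = W ⁻¹' Ioi v := fun W => by
        ext x
        simp [hu.trans_le (hN0 x)]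
      have h2 := congrArg (fun M => M (Ioi v)) hmap
      simp only [Measure.map_apply_of_aemeasurable hZ measurableSet_Ioi,
        Measure.map_apply_of_aemeasurable hgN measurableSet_Ioi] at h2
      rw [h1, h2, h1 fun x => g (N x)]
    · exact hpos u v hu hv
  have hlaw : m.map (fun x => (N x, Z x)) = m.map (fun x => (N x, g (N x))) := by
    have hspan : IsCountablySpanning (range (Ioi : ℝ → Set ℝ)) :=
      ⟨fun n : ℕ => Ioi (-(n : ℝ)), fun n => mem_range_self _, by
        ext x
        obtain ⟨n, hn⟩ := exists_nat_gt (-x)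
        simpa using ⟨n, by linarith⟩⟩
    have hgen : (borel ℝ) = MeasurableSpace.generateFrom (range Ioi) := borel_eq_generateFrom_Ioi ℝ
    have hb : (inferInstance : MeasurableSpace ℝ) = MeasurableSpace.generateFrom (range Ioi) := by
      rw [← hgen]
      exact BorelSpace.measurable_eq
    refine ext_of_generate_finite (image2 (· ×ˢ ·) (range Ioi) (range Ioi)) ?_
      (isPiSystem_Ioi.prod isPiSystem_Ioi) ?_ ?_
    · exact (generateFrom_eq_prod hb.symm hb.symm hspan hspan).symm
    · rintro _ ⟨_, ⟨u, rfl⟩, _, ⟨v, rfl⟩, rfl⟩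
      change m.map _ (Ioi u ×ˢ Ioi v) = m.map _ (Ioi u ×ˢ Ioi v)
      rw [Measure.map_apply_of_aemeasurable (hN.prodMk hZ)
          (measurableSet_Ioi.prod measurableSet_Ioi),
        Measure.map_apply_of_aemeasurable (hN.prodMk hgN)
          (measurableSet_Ioi.prod measurableSet_Ioi)]
      exact hall u v
    · rw [Measure.map_apply_of_aemeasurable (hN.prodMk hZ) .univ,
        Measure.map_apply_of_aemeasurable (hN.prodMk hgN) .univ]
      rfl
  have hgraph : MeasurableSet {w : ℝ × ℝ | w.2 = g w.1} :=
    measurableSet_eq_fun measurable_snd (hg.comp measurable_fst)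
  have h1 : ∀ᵐ w ∂(m.map fun x => (N x, g (N x))), w.2 = g w.1 :=
    (ae_map_iff (hN.prodMk hgN) hgraph).2 (Eventually.of_forall fun x => rfl)
  rw [← hlaw] at h1
  exact ae_of_ae_map (hN.prodMk hZ) h1

end Comonotone

/-! ### Optimality and uniqueness of direction-preserving transports -/

theorem planCost_map_prodMk {E Ω : Type*} [NormedAddCommGroup E] [MeasurableSpace E] [BorelSpace E]
    [SecondCountableTopology E] [MeasurableSpace Ω] {m : Measure Ω} {U V : Ω → E}
    (hU : AEMeasurable U m) (hV : AEMeasurable V m) :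
    planCost (m.map fun x => (U x, V x)) = ∫⁻ x, ‖U x - V x‖ₑ ^ 2 ∂m :=
  lintegral_map' (f := fun z : E × E => ‖z.1 - z.2‖ₑ ^ 2) (by fun_prop) (hU.prodMk hV)

theorem isCoupling_map_prodMk {E Ω : Type*} [MeasurableSpace E] [MeasurableSpace Ω]
    {m : Measure Ω} {U V : Ω → E} (hU : AEMeasurable U m) (hV : AEMeasurable V m) :
    IsCoupling (m.map U) (m.map V) (m.map fun x => (U x, V x)) :=
  ⟨Measure.fst_map_prodMk₀ hV, Measure.snd_map_prodMk₀ hU⟩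

section DirectionPreserving

open Filter Topology

variable {E : Type*} [NormedAddCommGroup E] [InnerProductSpace ℝ E]

theorem enorm_sq_add_enorm_sq_le (x y : E) :
    ‖x‖ₑ ^ 2 + ‖y‖ₑ ^ 2 ≤ ‖x - y‖ₑ ^ 2 + 2 * (‖x‖ₑ * ‖y‖ₑ) := by
  have h : ‖x‖ ^ 2 + ‖y‖ ^ 2 ≤ ‖x - y‖ ^ 2 + 2 * (‖x‖ * ‖y‖) := by
    rw [norm_sub_sq_real]
    linarith [real_inner_le_norm x y]
  rw [← ofReal_norm, ← ofReal_norm, ← ofReal_norm]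
  have := ENNReal.ofReal_le_ofReal h
  rwa [ENNReal.ofReal_add (by positivity) (by positivity),
    ENNReal.ofReal_add (by positivity) (by positivity), ENNReal.ofReal_mul (by positivity),
    ENNReal.ofReal_mul (by positivity), ENNReal.ofReal_pow (by positivity),
    ENNReal.ofReal_pow (by positivity), ENNReal.ofReal_pow (by positivity),
    ENNReal.ofReal_ofNat] at this

theorem enorm_sq_add_enorm_sq_eq_iff (x y : E) :
    ‖x‖ₑ ^ 2 + ‖y‖ₑ ^ 2 = ‖x - y‖ₑ ^ 2 + 2 * (‖x‖ₑ * ‖y‖ₑ) ↔ inner ℝ x y = ‖x‖ * ‖y‖ := by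
  have h : ‖x‖ ^ 2 + ‖y‖ ^ 2 = ‖x - y‖ ^ 2 + 2 * (‖x‖ * ‖y‖) ↔ inner ℝ x y = ‖x‖ * ‖y‖ := by
    rw [norm_sub_sq_real]
    constructor <;> intro h <;> linarith
  rw [← h, ← ofReal_norm, ← ofReal_norm, ← ofReal_norm,
    ← ENNReal.ofReal_eq_ofReal_iff (by positivity) (by positivity),
    ENNReal.ofReal_add (by positivity) (by positivity),
    ENNReal.ofReal_add (by positivity) (by positivity), ENNReal.ofReal_mul (by positivity),
    ENNReal.ofReal_mul (by positivity), ENNReal.ofReal_pow (by positivity),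
    ENNReal.ofReal_pow (by positivity), ENNReal.ofReal_pow (by positivity),
    ENNReal.ofReal_ofNat]

variable [MeasurableSpace E] [BorelSpace E] [SecondCountableTopology E]
  {Ω : Type*} [MeasurableSpace Ω] {m : Measure Ω}

theorem lintegral_enorm_sq_add_le {U V : Ω → E} (hU : AEMeasurable U m) (hV : AEMeasurable V m) :
    ∫⁻ x, ‖U x‖ₑ ^ 2 ∂m + ∫⁻ x, ‖V x‖ₑ ^ 2 ∂m ≤
      ∫⁻ x, ‖U x - V x‖ₑ ^ 2 ∂m + 2 * ∫⁻ x, ‖U x‖ₑ * ‖V x‖ₑ ∂m := by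
  rw [← lintegral_const_mul' _ _ ENNReal.ofNat_ne_top, ← lintegral_add_left' (by fun_prop),
    ← lintegral_add_left' (by fun_prop)]
  exact lintegral_mono fun x => enorm_sq_add_enorm_sq_le _ _

theorem lintegral_enorm_sq_add_eq {U V : Ω → E} (hU : AEMeasurable U m) (hV : AEMeasurable V m)
    (h : ∀ᵐ x ∂m, inner ℝ (U x) (V x) = ‖U x‖ * ‖V x‖) :
    ∫⁻ x, ‖U x‖ₑ ^ 2 ∂m + ∫⁻ x, ‖V x‖ₑ ^ 2 ∂m =
      ∫⁻ x, ‖U x - V x‖ₑ ^ 2 ∂m + 2 * ∫⁻ x, ‖U x‖ₑ * ‖V x‖ₑ ∂m := by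
  rw [← lintegral_const_mul' _ _ ENNReal.ofNat_ne_top, ← lintegral_add_left' (by fun_prop),
    ← lintegral_add_left' (by fun_prop)]
  exact lintegral_congr_ae (h.mono fun x hx => (enorm_sq_add_enorm_sq_eq_iff _ _).2 hx)

/-- If `U` and `V` point in the same direction and have comonotone norms, the coupling `(U, V)` of
their laws is optimal for the quadratic cost. -/
theorem lintegral_enorm_sub_sq_le_planCost [IsFiniteMeasure m] {U V : Ω → E}
    (hU : AEMeasurable U m) (hV : AEMeasurable V m)
    (hdir : ∀ᵐ x ∂m, inner ℝ (U x) (V x) = ‖U x‖ * ‖V x‖)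
    (hmono : AEComonotone m (fun x => ‖U x‖) (fun x => ‖V x‖))
    (hU2 : ∫⁻ x, ‖U x‖ₑ ^ 2 ∂m ≠ ⊤) (hV2 : ∫⁻ x, ‖V x‖ₑ ^ 2 ∂m ≠ ⊤)
    {p : Measure (E × E)} (hp : IsCoupling (m.map U) (m.map V) p) :
    ∫⁻ x, ‖U x - V x‖ₑ ^ 2 ∂m ≤ planCost p := by
  obtain ⟨hp1, hp2⟩ := hp
  have hpfin : IsFiniteMeasure p := by
    have : IsFiniteMeasure p.fst := by rw [hp1]; infer_instance
    exact ⟨by rw [← Measure.fst_univ]; exact measure_lt_top _ _⟩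
  have hp1' : p.map Prod.fst = m.map U := hp1
  have hp2' : p.map Prod.snd = m.map V := hp2
  have hA : ∫⁻ z, ‖z.1‖ₑ ^ 2 ∂p = ∫⁻ x, ‖U x‖ₑ ^ 2 ∂m := by
    rw [← lintegral_map' (f := fun y : E => ‖y‖ₑ ^ 2) (g := U) (by fun_prop) hU, ← hp1',
      lintegral_map (by fun_prop) measurable_fst]
  have hB : ∫⁻ z, ‖z.2‖ₑ ^ 2 ∂p = ∫⁻ x, ‖V x‖ₑ ^ 2 ∂m := by
    rw [← lintegral_map' (f := fun y : E => ‖y‖ₑ ^ 2) (g := V) (by fun_prop) hV, ← hp2',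
      lintegral_map (by fun_prop) measurable_snd]
  have hK : ∫⁻ z, ‖z.1‖ₑ * ‖z.2‖ₑ ∂p ≤ ∫⁻ x, ‖U x‖ₑ * ‖V x‖ₑ ∂m := by
    have h1 : p.map (fun z => ‖z.1‖) = m.map (fun x => ‖U x‖) := by
      have := congrArg (fun M => M.map norm) hp1'
      beta_reduce at this
      rwa [Measure.map_map measurable_norm measurable_fst,
        AEMeasurable.map_map_of_aemeasurable measurable_norm.aemeasurable hU] at this
    have h2 : p.map (fun z => ‖z.2‖) = m.map (fun x => ‖V x‖) := by
      have := congrArg (fun M => M.map norm) hp2'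
      beta_reduce at this
      rwa [Measure.map_map measurable_norm measurable_snd,
        AEMeasurable.map_map_of_aemeasurable measurable_norm.aemeasurable hV] at this
    simpa only [ofReal_norm] using
      hmono.lintegral_mul_le hU.norm hV.norm (by fun_prop) (by fun_prop) h1 h2
  have hp_le := lintegral_enorm_sq_add_le (m := p) (U := Prod.fst) (V := Prod.snd)
    (by fun_prop) (by fun_prop)
  have hm_eq := lintegral_enorm_sq_add_eq hU hV hdir
  have hfin : 2 * ∫⁻ x, ‖U x‖ₑ * ‖V x‖ₑ ∂m ≠ ⊤ :=
    ne_top_of_le_ne_top (ENNReal.add_ne_top.2 ⟨hU2, hV2⟩) (hm_eq ▸ le_add_self)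
  rw [hA, hB, hm_eq] at hp_le
  refine (ENNReal.add_le_add_iff_right hfin).1 (hp_le.trans ?_)
  exact add_le_add le_rfl (mul_le_mul_right hK 2)

/-- The Wasserstein distance is attained by a coupling with common directions and comonotone
norms. -/
theorem W2_map_eq [IsFiniteMeasure m] {U V : Ω → E}
    (hU : AEMeasurable U m) (hV : AEMeasurable V m)
    (hdir : ∀ᵐ x ∂m, inner ℝ (U x) (V x) = ‖U x‖ * ‖V x‖)
    (hmono : AEComonotone m (fun x => ‖U x‖) (fun x => ‖V x‖))
    (hU2 : ∫⁻ x, ‖U x‖ₑ ^ 2 ∂m ≠ ⊤) (hV2 : ∫⁻ x, ‖V x‖ₑ ^ 2 ∂m ≠ ⊤) :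
    W2 (m.map U) (m.map V) = (∫⁻ x, ‖U x - V x‖ₑ ^ 2 ∂m) ^ (1 / 2 : ℝ) := by
  unfold W2
  congr 1
  refine le_antisymm ?_
    (le_iInf₂ fun p hp => lintegral_enorm_sub_sq_le_planCost hU hV hdir hmono hU2 hV2 hp)
  rw [← planCost_map_prodMk hU hV]
  exact iInf₂_le _ (isCoupling_map_prodMk hU hV)

/-- A direction-preserving transport whose norm is a monotone function of the norm is the unique
optimal transport map. For a competitor `S`, equality has to hold both in the rearrangement
inequality, so `‖S x‖ = ‖T x‖`, and in the Cauchy–Schwarz inequality, so `S x` is parallel to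
`x`. -/
theorem isTheOptimalTransport_of_comonotone {μ : Measure E} [IsFiniteMeasure μ] {T : E → E}
    {g : ℝ → ℝ} (hT : Measurable T) (hg : Measurable g) (hTg : ∀ᵐ x ∂μ, ‖T x‖ = g ‖x‖)
    (h0 : ∀ᵐ x ∂μ, x ≠ 0) (hdir : ∀ᵐ x ∂μ, inner ℝ x (T x) = ‖x‖ * ‖T x‖)
    (hmono : AEComonotone μ (fun x => ‖x‖) (g ∘ fun x => ‖x‖))
    (hμ2 : ∫⁻ x, ‖x‖ₑ ^ 2 ∂μ ≠ ⊤) (hT2 : ∫⁻ x, ‖T x‖ₑ ^ 2 ∂μ ≠ ⊤) :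
    IsTheOptimalTransport μ (μ.map T) T := by
  have hmono' : AEComonotone μ (fun x => ‖x‖) (fun x => ‖T x‖) := by
    obtain ⟨G, hG, h⟩ := hmono
    refine ⟨G ∩ {x | ‖T x‖ = g ‖x‖}, hG.and hTg, fun x hx y hy hxy => ?_⟩
    change ‖T x‖ ≤ ‖T y‖
    rw [show ‖T x‖ = g ‖x‖ from hx.2, show ‖T y‖ = g ‖y‖ from hy.2]
    exact h x hx.1 y hy.1 hxy
  have hcost : ∀ p : Measure (E × E), IsCoupling μ (μ.map T) p →
      ∫⁻ x, ‖x - T x‖ₑ ^ 2 ∂μ ≤ planCost p := fun p hp =>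
    lintegral_enorm_sub_sq_le_planCost (U := fun x => x) aemeasurable_id hT.aemeasurable hdir
      hmono' hμ2 hT2 (by rwa [show μ.map (fun x => x) = μ from Measure.map_id])
  refine ⟨⟨hT.aemeasurable, rfl, hcost⟩, fun S hS => ?_⟩
  have hSm := hS.aemeasurable
  have hB : ∫⁻ x, ‖S x‖ₑ ^ 2 ∂μ = ∫⁻ x, ‖T x‖ₑ ^ 2 ∂μ := by
    rw [← lintegral_map' (f := fun y : E => ‖y‖ₑ ^ 2) (g := S) (by fun_prop) hSm, hS.map_eq,
      lintegral_map (by fun_prop) hT]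
  have hSle : ∫⁻ x, ‖x - S x‖ₑ ^ 2 ∂μ ≤ ∫⁻ x, ‖x - T x‖ₑ ^ 2 ∂μ := by
    rw [← planCost_map_prodMk (U := fun x => x) aemeasurable_id hT.aemeasurable]
    refine hS.le_cost _ ?_
    have := isCoupling_map_prodMk (m := μ) (U := fun x => x) aemeasurable_id hT.aemeasurable
    rwa [show μ.map (fun x => x) = μ from Measure.map_id] at this
  have hTeq := lintegral_enorm_sq_add_eq (U := fun x => x) aemeasurable_id hT.aemeasurable hdir
  have hSineq := lintegral_enorm_sq_add_le (m := μ) (U := fun x => x) aemeasurable_id hSm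
  have hKfin : 2 * ∫⁻ x, ‖x‖ₑ * ‖T x‖ₑ ∂μ ≠ ⊤ :=
    ne_top_of_le_ne_top (ENNReal.add_ne_top.2 ⟨hμ2, hT2⟩) (hTeq ▸ le_add_self)
  have hcfin : ∫⁻ x, ‖x - T x‖ₑ ^ 2 ∂μ ≠ ⊤ :=
    ne_top_of_le_ne_top (ENNReal.add_ne_top.2 ⟨hμ2, hT2⟩) (hTeq ▸ le_self_add)
  have hKle : ∫⁻ x, ‖x‖ₑ * ‖T x‖ₑ ∂μ ≤ ∫⁻ x, ‖x‖ₑ * ‖S x‖ₑ ∂μ := by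
    have h1 := hSineq.trans (add_le_add hSle le_rfl)
    rw [hB, hTeq] at h1
    have h2 := (ENNReal.add_le_add_iff_left hcfin).1 h1
    exact (ENNReal.mul_le_mul_iff_right two_ne_zero ENNReal.ofNat_ne_top).1 h2
  have hKT : ∫⁻ x, ENNReal.ofReal ‖x‖ * ENNReal.ofReal (g ‖x‖) ∂μ =
      ∫⁻ x, ‖x‖ₑ * ‖T x‖ₑ ∂μ :=
    lintegral_congr_ae (hTg.mono fun x hx => by simp only [← hx, ofReal_norm])
  have hnorm : (fun x => ‖S x‖) =ᵐ[μ] g ∘ fun x => ‖x‖ := by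
    refine ae_eq_comp_of_lintegral_mul_le measurable_norm.aemeasurable hSm.norm hg hmono
      (fun x => norm_nonneg _) (fun x => norm_nonneg _) ?_ ?_ ?_
    · have h1 : (g ∘ fun x : E => ‖x‖) =ᵐ[μ] fun x => ‖T x‖ := hTg.mono fun x hx => hx.symm
      have h2 : μ.map (fun x => ‖S x‖) = (μ.map S).map norm :=
        (AEMeasurable.map_map_of_aemeasurable measurable_norm.aemeasurable hSm).symm
      rw [Measure.map_congr h1, h2, hS.map_eq, Measure.map_map measurable_norm hT]
      rfl
    · rw [hKT]
      exact fun h => hKfin (by rw [h]; exact ENNReal.mul_top two_ne_zero)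
    · rw [hKT]
      simpa only [ofReal_norm] using hKle
  have hKeq : ∫⁻ x, ‖x‖ₑ * ‖S x‖ₑ ∂μ = ∫⁻ x, ‖x‖ₑ * ‖T x‖ₑ ∂μ := by
    refine lintegral_congr_ae ?_
    filter_upwards [hnorm, hTg] with x h1 h2
    have h3 : ‖S x‖ = ‖T x‖ := h1.trans h2.symm
    rw [← ofReal_norm (S x), h3, ofReal_norm]
  have hpar : ∀ᵐ x ∂μ, inner ℝ x (S x) = ‖x‖ * ‖S x‖ := by
    have hle : ∫⁻ x, (‖x - S x‖ₑ ^ 2 + 2 * (‖x‖ₑ * ‖S x‖ₑ)) ∂μ ≤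
        ∫⁻ x, (‖x‖ₑ ^ 2 + ‖S x‖ₑ ^ 2) ∂μ := by
      rw [lintegral_add_left' (by fun_prop), lintegral_add_left' (by fun_prop),
        lintegral_const_mul' _ _ ENNReal.ofNat_ne_top, hKeq, hB, hTeq]
      exact add_le_add hSle le_rfl
    have hfin : ∫⁻ x, (‖x‖ₑ ^ 2 + ‖S x‖ₑ ^ 2) ∂μ ≠ ⊤ := by
      rw [lintegral_add_left' (by fun_prop), hB]
      exact ENNReal.add_ne_top.2 ⟨hμ2, hT2⟩
    have := ae_eq_of_ae_le_of_lintegral_le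
      (Eventually.of_forall fun x => enorm_sq_add_enorm_sq_le x (S x)) hfin (by fun_prop) hle
    exact this.mono fun x hx => (enorm_sq_add_enorm_sq_eq_iff _ _).1 hx
  filter_upwards [hnorm, hTg, hpar, hdir, h0] with x h1 h2 h3 h4 h5
  have h6 : ‖S x‖ = ‖T x‖ := h1.trans h2.symm
  rw [inner_eq_norm_mul_iff_real] at h3 h4
  refine smul_right_injective E (norm_ne_zero_iff.2 h5) ?_
  change ‖x‖ • S x = ‖x‖ • T x
  rw [← h3, ← h4, h6]

end DirectionPreserving

/-! ### Radial maps -/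

/-- The map `x ↦ g(‖x‖) x/‖x‖`, with value `0` at the origin. -/
noncomputable def radialMap {E : Type*} [NormedAddCommGroup E] [NormedSpace ℝ E] (g : ℝ → ℝ)
    (x : E) : E :=
  g ‖x‖ • ((1 / ‖x‖) • x)

section RadialMap

open Filter Topology

variable {E : Type*} [NormedAddCommGroup E] [NormedSpace ℝ E] {g : ℝ → ℝ}

theorem norm_radialMap {x : E} (hx : x ≠ 0) (hg : 0 ≤ g ‖x‖) : ‖radialMap g x‖ = g ‖x‖ := by
  have := norm_ne_zero_iff.2 hx
  rw [radialMap, norm_smul, norm_smul, Real.norm_of_nonneg hg, norm_div, norm_one, norm_norm,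
    one_div_mul_cancel this, mul_one]

theorem measurable_radialMap [MeasurableSpace E] [BorelSpace E] [SecondCountableTopology E]
    (hg : Measurable g) : Measurable (radialMap g : E → E) :=
  (hg.comp measurable_norm).smul ((measurable_const.div measurable_norm).smul measurable_id)

theorem injOn_radialMap {R : Set ℝ} (hg : StrictMonoOn g R) (hR : ∀ r ∈ R, 0 < r)
    (hpos : ∀ r ∈ R, 0 < g r) : Set.InjOn (radialMap g : E → E) {x | ‖x‖ ∈ R} := by
  intro x hx y hy hxy
  have hx0 := hR _ hx
  have hy0 := hR _ hy
  have hnorm : ‖x‖ = ‖y‖ := by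
    refine hg.injOn hx hy ?_
    rw [← norm_radialMap (norm_pos_iff.1 hx0) (hpos _ hx).le,
      ← norm_radialMap (norm_pos_iff.1 hy0) (hpos _ hy).le, hxy]
  unfold radialMap at hxy
  rw [hnorm] at hxy
  have h1 := smul_right_injective E (hpos _ hy).ne' hxy
  exact smul_right_injective E (one_div_pos.2 hy0).ne' h1

variable {F : Type*} [NormedAddCommGroup F] [InnerProductSpace ℝ F]

theorem inner_radialMap_radialMap (g h : ℝ → ℝ) {x : F} (hx : x ≠ 0) :
    inner ℝ (radialMap g x) (radialMap h x) = g ‖x‖ * h ‖x‖ := by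
  have := norm_ne_zero_iff.2 hx
  simp only [radialMap, real_inner_smul_left, real_inner_smul_right, real_inner_self_eq_norm_sq]
  field_simp

/-- If `g - c • id` is nonnegative and increasing, `radialMap g` is `c • id` plus a monotone map,
so it expands distances by at least `c`. -/
theorem mul_norm_sub_le_norm_radialMap_sub {c : ℝ} {x y : F} (hx : x ≠ 0) (hy : y ≠ 0)
    (hgx : c * ‖x‖ ≤ g ‖x‖) (hgy : c * ‖y‖ ≤ g ‖y‖)
    (hmono : 0 ≤ (‖x‖ - ‖y‖) * ((g ‖x‖ - c * ‖x‖) - (g ‖y‖ - c * ‖y‖))) :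
    c * ‖x - y‖ ≤ ‖radialMap g x - radialMap g y‖ := by
  rcases eq_or_ne x y with rfl | hxy
  · simp
  have ha : 0 < ‖x‖ := norm_pos_iff.2 hx
  have hb : 0 < ‖y‖ := norm_pos_iff.2 hy
  have hpos : 0 < ‖x - y‖ := norm_pos_iff.2 (sub_ne_zero.2 hxy)
  have hcs : inner ℝ x y ≤ ‖x‖ * ‖y‖ := real_inner_le_norm x y
  have hinner : inner ℝ (radialMap g x - radialMap g y) (x - y) =
      g ‖x‖ * ‖x‖ + g ‖y‖ * ‖y‖ - (g ‖x‖ / ‖x‖ + g ‖y‖ / ‖y‖) * inner ℝ x y := by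
    simp only [radialMap, inner_sub_left, inner_sub_right, real_inner_smul_left,
      real_inner_self_eq_norm_sq, real_inner_comm x y]
    field_simp
    ring
  have hsq : ‖x - y‖ ^ 2 = ‖x‖ ^ 2 + ‖y‖ ^ 2 - 2 * inner ℝ x y := by
    rw [norm_sub_sq_real]; ring
  have hkey : c * ‖x - y‖ ^ 2 ≤ inner ℝ (radialMap g x - radialMap g y) (x - y) := by
    have h1 : 0 ≤ (g ‖x‖ - c * ‖x‖) / ‖x‖ + (g ‖y‖ - c * ‖y‖) / ‖y‖ :=
      add_nonneg (div_nonneg (by linarith) ha.le) (div_nonneg (by linarith) hb.le)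
    have h2 : g ‖x‖ / ‖x‖ + g ‖y‖ / ‖y‖ =
        (g ‖x‖ - c * ‖x‖) / ‖x‖ + (g ‖y‖ - c * ‖y‖) / ‖y‖ + 2 * c := by
      field_simp
      ring
    have h3 := mul_le_mul_of_nonneg_left hcs h1
    have h4 : ((g ‖x‖ - c * ‖x‖) / ‖x‖ + (g ‖y‖ - c * ‖y‖) / ‖y‖) * (‖x‖ * ‖y‖) =
        (g ‖x‖ - c * ‖x‖) * ‖y‖ + (g ‖y‖ - c * ‖y‖) * ‖x‖ := by
      field_simp
    rw [hinner, hsq, h2]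
    nlinarith
  have := hkey.trans (real_inner_le_norm _ _)
  rw [pow_two, ← mul_assoc] at this
  exact le_of_mul_le_mul_right this hpos

/-- A map expanding distances on a conull set pulls null sets back to null sets, since its inverse
is Lipschitz. -/
theorem map_absolutelyContinuous_of_expanding [MeasurableSpace F] [BorelSpace F]
    [FiniteDimensional ℝ F] {vol μ : Measure F} [vol.IsAddHaarMeasure] (hμ : μ ≪ vol) {T : F → F}
    (hT : Measurable T) {G : Set F} (hG : ∀ᵐ x ∂μ, x ∈ G) {c : ℝ} (hc : 0 < c)
    (hexp : ∀ x ∈ G, ∀ y ∈ G, c * ‖x - y‖ ≤ ‖T x - T y‖) : μ.map T ≪ vol := by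
  -- the Hausdorff measure, unlike `vol`, is also available on the subtype `G`
  set H : Measure F := Measure.hausdorffMeasure (Module.finrank ℝ F) with hH
  have h1 : H ≪ vol := Measure.absolutelyContinuous_isAddHaarMeasure _ _
  have h2 : vol ≪ H := Measure.absolutelyContinuous_isAddHaarMeasure _ _
  refine Measure.AbsolutelyContinuous.mk fun N hN hN0 => ?_
  rw [Measure.map_apply hT hN]
  have hanti : AntilipschitzWith (c⁻¹).toNNReal (fun x : G => T x) := by
    refine AntilipschitzWith.of_le_mul_dist fun x y => ?_
    rw [Real.coe_toNNReal _ (inv_nonneg.2 hc.le), Subtype.dist_eq, dist_eq_norm, dist_eq_norm,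
      inv_mul_eq_div, le_div_iff₀' hc]
    exact hexp x x.2 y y.2
  have h3 : (Measure.hausdorffMeasure (Module.finrank ℝ F) : Measure G)
      ((fun x : G => T x) ⁻¹' N) = 0 := by
    have := hanti.hausdorffMeasure_preimage_le (d := Module.finrank ℝ F) (Nat.cast_nonneg _) N
    rw [show Measure.hausdorffMeasure (Module.finrank ℝ F) N = 0 from h1 hN0, mul_zero] at this
    exact le_antisymm this bot_le
  have h4 : H (Subtype.val '' ((fun x : G => T x) ⁻¹' N)) = 0 := by
    rw [hH, isometry_subtype_coe.hausdorffMeasure_image (Or.inl (Nat.cast_nonneg _)), h3]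
  have h5 : μ (Subtype.val '' ((fun x : G => T x) ⁻¹' N)) = 0 := hμ (h2 h4)
  refine measure_mono_null_ae ?_ h5
  filter_upwards [hG] with x hx hxN
  exact ⟨⟨x, hx⟩, hxN, rfl⟩

/-- A measurable map that is injective on a conull set has a measurable almost everywhere left
inverse. -/
theorem exists_measurable_ae_leftInverse {X : Type*} [MeasurableSpace X] [StandardBorelSpace X]
    [Nonempty X] {μ : Measure X} {T : X → X} (hT : Measurable T) {G : Set X}
    (hGm : MeasurableSet G) (hG : ∀ᵐ x ∂μ, x ∈ G) (hinj : Set.InjOn T G) :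
    ∃ S : X → X, Measurable S ∧ ∀ᵐ x ∂μ, S (T x) = x := by
  have : StandardBorelSpace G := hGm.standardBorel
  have hemb : MeasurableEmbedding (fun x : G => T x) :=
    (hT.comp measurable_subtype_coe).measurableEmbedding hinj.injective
  obtain ⟨S, hS, hST⟩ := hemb.exists_measurable_extend measurable_subtype_coe fun _ => ‹Nonempty X›
  refine ⟨S, hS, hG.mono fun x hx => ?_⟩
  exact congrFun hST ⟨x, hx⟩

end RadialMap

/-- A radial map transports one isotropic measure to another as soon as it does so for the laws of
the norm. -/
theorem map_radialMap_isotropic {d : ℕ} [Nontrivial (Freq d)] {C C' : ℝ → ℝ}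
    (hC : AEMeasurable (isotropic d C) volume) (hC' : AEMeasurable (isotropic d C') volume)
    {g : ℝ → ℝ} (hg : Measurable g)
    (hpos : ∀ᵐ k ∂spectralMeasure (isotropic d C), 0 < ‖k‖)
    (hmap : (spectralMeasure (isotropic d C)).map (fun k => g ‖k‖) =
      (spectralMeasure (isotropic d C')).map fun k => ‖k‖) :
    (spectralMeasure (isotropic d C)).map (radialMap g) = spectralMeasure (isotropic d C') := by
  have hgm : Measurable (radialMap g : Freq d → Freq d) := measurable_radialMap hg
  refine Measure.ext_of_lintegral _ fun h hh => ?_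
  have hS : (volume : Measure (Freq d)).toSphere Set.univ ≠ 0 := by
    rw [Measure.measure_univ_ne_zero]
    exact Measure.toSphere_ne_zero _
  refine (ENNReal.mul_right_inj hS (measure_ne_top _ _)).1 ?_
  rw [lintegral_map hh hgm,
    lintegral_isotropic hC (h := fun k => h (radialMap g k)) (hh.comp hgm),
    lintegral_isotropic hC' hh]
  refine lintegral_congr fun s => ?_
  have hs : Measurable fun r : ℝ => h (r • (s : Freq d)) := by fun_prop
  calc ∫⁻ k, h (radialMap g (‖k‖ • (s : Freq d))) ∂spectralMeasure (isotropic d C)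
      = ∫⁻ k, h (g ‖k‖ • (s : Freq d)) ∂spectralMeasure (isotropic d C) := by
        refine lintegral_congr_ae (hpos.mono fun k hk => ?_)
        have hn : ‖‖k‖ • (s : Freq d)‖ = ‖k‖ := by
          rw [norm_smul, norm_norm, norm_eq_of_mem_sphere, mul_one]
        simp only [radialMap]
        rw [hn, smul_smul (1 / ‖k‖), one_div_mul_cancel hk.ne', one_smul]
    _ = ∫⁻ r, h (r • (s : Freq d)) ∂(spectralMeasure (isotropic d C)).map (fun k => g ‖k‖) :=
        (lintegral_map hs (hg.comp measurable_norm)).symm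
    _ = ∫⁻ k, h (‖k‖ • (s : Freq d)) ∂spectralMeasure (isotropic d C') := by
        rw [hmap, lintegral_map hs measurable_norm]

/-! ### Spectral measures -/

section SpectralMeasure

variable {d : ℕ}

theorem memLp_two_iff_lintegral_enorm_sq {α E : Type*} [MeasurableSpace α] [NormedAddCommGroup E]
    {μ : Measure α} {f : α → E} (hf : AEStronglyMeasurable f μ) :
    MemLp f 2 μ ↔ ∫⁻ x, ‖f x‖ₑ ^ 2 ∂μ ≠ ⊤ := by
  rw [MemLp, and_iff_right hf,
    eLpNorm_lt_top_iff_lintegral_rpow_enorm_lt_top two_ne_zero ENNReal.ofNat_ne_top,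
    lt_top_iff_ne_top]
  simp

theorem spectralMeasure_univ {f : Freq d → ℝ} (hf : IsSpectralDensity f) :
    spectralMeasure f Set.univ = ENNReal.ofReal (∫ k, f k) := by
  rw [spectralMeasure, withDensity_apply _ .univ, Measure.restrict_univ,
    ofReal_integral_eq_lintegral_ofReal hf.integrable (Filter.Eventually.of_forall hf.nonneg)]

theorem isFiniteMeasure_spectralMeasure {f : Freq d → ℝ} (hf : IsSpectralDensity f) :
    IsFiniteMeasure (spectralMeasure f) :=
  ⟨by rw [spectralMeasure_univ hf]; exact ENNReal.ofReal_lt_top⟩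

theorem spectralMeasure_absolutelyContinuous (f : Freq d → ℝ) : spectralMeasure f ≪ volume :=
  withDensity_absolutelyContinuous _ _

theorem map_neg_spectralMeasure {f : Freq d → ℝ} (hf : ∀ k, f (-k) = f k) :
    (spectralMeasure f).map (fun k => -k) = spectralMeasure f := by
  ext A hA
  have hA' : MeasurableSet ((fun k : Freq d => -k) ⁻¹' A) := measurable_neg hA
  rw [Measure.map_apply measurable_neg hA, spectralMeasure, withDensity_apply _ hA',
    withDensity_apply _ hA, ← lintegral_indicator hA, ← lintegral_indicator hA',
    ← (Measure.measurePreserving_neg (volume : Measure (Freq d))).lintegral_comp_emb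
      (MeasurableEquiv.neg (Freq d)).measurableEmbedding]
  refine lintegral_congr fun k => ?_
  have hk : -k ∈ (fun k : Freq d => -k) ⁻¹' A ↔ k ∈ A := by
    change - -k ∈ A ↔ k ∈ A
    rw [neg_neg]
  by_cases h : k ∈ A
  · rw [Set.indicator_of_mem (hk.2 h), Set.indicator_of_mem h, hf]
  · rw [Set.indicator_of_notMem (mt hk.1 h), Set.indicator_of_notMem h]

theorem lintegral_enorm_sq_spectralMeasure {f : Freq d → ℝ} (hf : IsSpectralDensity f) :
    ∫⁻ k, ‖k‖ₑ ^ 2 ∂spectralMeasure f = ∫⁻ k, ‖‖k‖ ^ 2 * f k‖ₑ := by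
  rw [spectralMeasure, lintegral_withDensity_eq_lintegral_mul₀
    hf.integrable.aestronglyMeasurable.aemeasurable.ennreal_ofReal (by fun_prop)]
  refine lintegral_congr fun k => ?_
  rw [enorm_mul, enorm_pow, enorm_norm, Real.enorm_of_nonneg (hf.nonneg k), mul_comm]
  rfl

theorem memLp_id_spectralMeasure {m : ℝ} {f : Freq d → ℝ} (hf : IsSpectralDensityOfMass m f) :
    MemLp (fun k => k) 2 (spectralMeasure f) := by
  rw [memLp_two_iff_lintegral_enorm_sq (by fun_prop),
    lintegral_enorm_sq_spectralMeasure hf.toIsSpectralDensity]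
  exact hf.second_moment.hasFiniteIntegral.ne

/-- An absolutely continuous, symmetric, finite measure with finite second moment has a spectral
density. The Radon–Nikodym derivative is even only almost everywhere, so it is symmetrised. -/
theorem exists_isSpectralDensityOfMass {M : Measure (Freq d)} [IsFiniteMeasure M]
    (hM : M ≪ volume) (heven : M.map (fun k => -k) = M) {m : ℝ} (hm : 0 ≤ m)
    (hmass : M Set.univ = ENNReal.ofReal m) (h2 : MemLp (fun k => k) 2 M) :
    ∃ f : Freq d → ℝ, IsSpectralDensityOfMass m f ∧ M = spectralMeasure f := by
  set r := M.rnDeriv volume with hr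
  have hrm : Measurable r := Measure.measurable_rnDeriv _ _
  have hMr : volume.withDensity r = M := Measure.withDensity_rnDeriv_eq _ _ hM
  have hsymm : (fun k => r (-k)) =ᵐ[volume] r := by
    have hfin : ∫⁻ k, r (-k) ≠ ⊤ := by
      rw [(Measure.measurePreserving_neg (volume : Measure (Freq d))).lintegral_comp hrm,
        ← setLIntegral_univ, ← withDensity_apply _ .univ, hMr]
      exact measure_ne_top _ _
    refine (withDensity_eq_iff (by fun_prop) hrm.aemeasurable hfin).1 ?_
    rw [hMr]
    ext A hA
    have hA' : MeasurableSet ((fun k : Freq d => -k) ⁻¹' A) := measurable_neg hA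
    conv_rhs => rw [← heven, Measure.map_apply measurable_neg hA, ← hMr]
    rw [withDensity_apply _ hA, withDensity_apply _ hA', ← lintegral_indicator hA,
      ← lintegral_indicator hA',
      ← (Measure.measurePreserving_neg (volume : Measure (Freq d))).lintegral_comp_emb
        (MeasurableEquiv.neg (Freq d)).measurableEmbedding]
    refine lintegral_congr fun k => ?_
    have hk : k ∈ (fun k : Freq d => -k) ⁻¹' A ↔ -k ∈ A := Iff.rfl
    by_cases h : -k ∈ A
    · rw [Set.indicator_of_mem (hk.2 h), Set.indicator_of_mem h, neg_neg]
    · rw [Set.indicator_of_notMem (mt hk.1 h), Set.indicator_of_notMem h]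
  set f : Freq d → ℝ := fun k => ((r k).toReal + (r (-k)).toReal) / 2 with hf
  have hfm : Measurable f := by fun_prop
  have hf0 : ∀ k, 0 ≤ f k := fun k => by positivity
  have hfr : (fun k => ENNReal.ofReal (f k)) =ᵐ[volume] r := by
    filter_upwards [hsymm, Measure.rnDeriv_lt_top M volume] with k h1 h3
    rw [hf]
    beta_reduce
    rw [h1, add_self_div_two, ENNReal.ofReal_toReal h3.ne]
  have hMf : M = spectralMeasure f := by
    rw [spectralMeasure, withDensity_congr_ae hfr, hMr]
  have hlint : ∫⁻ k, ENNReal.ofReal (f k) = ENNReal.ofReal m := by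
    rw [← hmass, hMf, spectralMeasure, withDensity_apply _ .univ, Measure.restrict_univ]
  have hint : Integrable f := by
    refine ⟨hfm.aestronglyMeasurable, ?_⟩
    rw [hasFiniteIntegral_iff_ofReal (Filter.Eventually.of_forall hf0), hlint]
    exact ENNReal.ofReal_lt_top
  have hdens : IsSpectralDensity f :=
    ⟨hf0, fun k => by simp only [hf, neg_neg, add_comm], hint⟩
  refine ⟨f, ⟨hdens, ?_, ?_⟩, hMf⟩
  · rw [integral_eq_lintegral_of_nonneg_ae (Filter.Eventually.of_forall hf0)
      hfm.aestronglyMeasurable, hlint, ENNReal.toReal_ofReal hm]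
  · refine ⟨by fun_prop, ?_⟩
    rw [HasFiniteIntegral, ← lintegral_enorm_sq_spectralMeasure hdens, ← hMf]
    exact ((memLp_two_iff_lintegral_enorm_sq (by fun_prop)).1 h2).lt_top

/-- The push-forward of `μ` under the norm, divided by `m`. It is a probability measure when `μ` has
total mass `m`. -/
noncomputable def normLaw (m : ℝ) (μ : Measure (Freq d)) : Measure ℝ :=
  (ENNReal.ofReal m)⁻¹ • μ.map norm

theorem normLaw_apply (m : ℝ) (μ : Measure (Freq d)) {A : Set ℝ} (hA : MeasurableSet A) :
    normLaw m μ A = (ENNReal.ofReal m)⁻¹ * μ (norm ⁻¹' A) := by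
  rw [normLaw, Measure.smul_apply, Measure.map_apply measurable_norm hA, smul_eq_mul]

theorem isProbabilityMeasure_normLaw {m : ℝ} (hm : 0 < m) {μ : Measure (Freq d)}
    (hμ : μ Set.univ = ENNReal.ofReal m) : IsProbabilityMeasure (normLaw m μ) :=
  ⟨by rw [normLaw_apply m μ .univ, Set.preimage_univ, hμ,
    ENNReal.inv_mul_cancel (ENNReal.ofReal_pos.2 hm).ne' ENNReal.ofReal_ne_top]⟩

theorem nullSingletonClass_normLaw [Nontrivial (Freq d)] (m : ℝ) {μ : Measure (Freq d)}
    (hμ : μ ≪ volume) : NullSingletonClass (normLaw m μ) := by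
  refine ⟨fun r => ?_⟩
  have : norm ⁻¹' {r} = Metric.sphere (0 : Freq d) r := by
    ext k
    simp
  rw [normLaw_apply m μ (measurableSet_singleton r), this,
    hμ (Measure.addHaar_sphere volume (0 : Freq d) r), mul_zero]

theorem normLaw_Iio_zero (m : ℝ) (μ : Measure (Freq d)) : normLaw m μ (Set.Iio 0) = 0 := by
  have : norm ⁻¹' Set.Iio (0 : ℝ) = (∅ : Set (Freq d)) := by
    ext k
    simp
  rw [normLaw_apply m μ measurableSet_Iio, this, measure_empty, mul_zero]

open ProbabilityTheory in
theorem radialCDF_eq_cdf_normLaw [Nontrivial (Freq d)] (hd : 1 ≤ d) {σ : ℝ} (hσ : 0 < σ)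
    {C : ℝ → ℝ} (hC : IsSpectralDensityOfMass (σ ^ 2) (isotropic d C)) {r : ℝ} (hr : 0 ≤ r) :
    radialCDF d σ C r = cdf (normLaw (σ ^ 2) (spectralMeasure (isotropic d C))) r := by
  have hprob := isProbabilityMeasure_normLaw (m := σ ^ 2) (by positivity)
    (hC.mass ▸ spectralMeasure_univ hC.toIsSpectralDensity)
  have : norm ⁻¹' Set.Iic r = Metric.closedBall (0 : Freq d) r := by
    ext k
    simp
  rw [radialCDF_eq_measureReal_closedBall hd σ hC.toIsSpectralDensity hr, cdf_eq_real,
    measureReal_def, measureReal_def, normLaw_apply _ _ measurableSet_Iic, this,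
    ENNReal.toReal_mul, ENNReal.toReal_inv, ENNReal.toReal_ofReal (by positivity)]

end SpectralMeasure

/-! ### The continuity equation -/

/-- Test functions are differentiated along the straight trajectories `s ↦ k + s η_k`, under the
integral sign. -/
theorem solvesContinuityEq_spectralCurve {d : ℕ} {f : Freq d → ℝ} {η : Freq d → Freq d}
    [IsFiniteMeasure (spectralMeasure f)] (hη : Measurable η)
    (hint : Integrable η (spectralMeasure f)) {t₀ : ℝ} {S : ℝ → Freq d → Freq d}
    (hS : ∀ t ∈ Set.Icc 0 t₀, Measurable (S t) ∧
      ∀ᵐ k ∂spectralMeasure f, S t (flowMap η t k) = k) :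
    SolvesContinuityEq t₀ (spectralCurve f η) fun t k => η (S t k) := by
  intro φ hφ hsupp t ht
  obtain ⟨hSm, hSinv⟩ := hS t ht
  have hflow : ∀ s, Measurable (flowMap η s) := fun s => by unfold flowMap; fun_prop
  have hdiff : Differentiable ℝ φ := hφ.differentiable (by simp)
  have hgrad_cont : Continuous (gradient φ) :=
    (InnerProductSpace.toDual ℝ (Freq d)).symm.continuous.comp
      (hφ.continuous_fderiv (by simp))
  obtain ⟨M, hM⟩ : ∃ M, ∀ k, ‖gradient φ k‖ ≤ M := by
    obtain ⟨M, hM⟩ := (hsupp.fderiv (𝕜 := ℝ)).exists_bound_of_continuous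
      (hφ.continuous_fderiv (by simp))
    exact ⟨M, fun k => by
      rw [gradient, LinearIsometryEquiv.norm_map]
      exact hM k⟩
  have hderiv : ∀ k s, HasDerivAt (fun s => φ (flowMap η s k))
      (inner ℝ (gradient φ (flowMap η s k)) (η k)) s := by
    intro k s
    have h1 : HasDerivAt (fun s : ℝ => flowMap η s k) (η k) s := by
      simpa [flowMap] using ((hasDerivAt_id s).smul_const (η k)).const_add k
    have h2 : inner ℝ (gradient φ (flowMap η s k)) (η k) = fderiv ℝ φ (flowMap η s k) (η k) := by
      simp
    rw [h2]
    exact (hdiff (flowMap η s k)).hasFDerivAt.comp_hasDerivAt s h1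
  have hbound : ∀ s, ∀ k, ‖inner ℝ (gradient φ (flowMap η s k)) (η k)‖ ≤ M * ‖η k‖ :=
    fun s k => (norm_inner_le_norm _ _).trans
      (mul_le_mul_of_nonneg_right (hM _) (norm_nonneg _))
  have hmeas : ∀ s, Measurable fun k => inner ℝ (gradient φ (flowMap η s k)) (η k) := fun s =>
    (hgrad_cont.measurable.comp (hflow s)).inner hη
  have hint_inner : ∀ s,
      Integrable (fun k => inner ℝ (gradient φ (flowMap η s k)) (η k)) (spectralMeasure f) :=
    fun s => (hint.norm.const_mul M).mono' (hmeas s).aestronglyMeasurable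
      (Filter.Eventually.of_forall (hbound s))
  have hφint : ∀ s, Integrable (fun k => φ (flowMap η s k)) (spectralMeasure f) := by
    intro s
    obtain ⟨B, hB⟩ := hsupp.exists_bound_of_continuous hφ.continuous
    exact Integrable.of_bound (hφ.continuous.measurable.comp (hflow s)).aestronglyMeasurable B
      (Filter.Eventually.of_forall fun k => hB _)
  have hvm : Measurable fun k => inner ℝ (gradient φ k) (η (S t k)) :=
    hgrad_cont.measurable.inner (hη.comp hSm)
  have hcongr : (fun k => inner ℝ (gradient φ (flowMap η t k)) (η (S t (flowMap η t k))))
      =ᵐ[spectralMeasure f] fun k => inner ℝ (gradient φ (flowMap η t k)) (η k) :=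
    hSinv.mono fun k hk => by beta_reduce; rw [hk]
  constructor
  · rw [spectralCurve, integrable_map_measure hvm.aestronglyMeasurable (hflow t).aemeasurable]
    exact (hint_inner t).congr hcongr.symm
  · have h1 := (hasDerivAt_integral_of_dominated_loc_of_deriv_le (μ := spectralMeasure f)
      (F := fun s k => φ (flowMap η s k))
      (F' := fun s k => inner ℝ (gradient φ (flowMap η s k)) (η k)) (x₀ := t) (s := Set.univ)
      (bound := fun k => M * ‖η k‖) Filter.univ_mem
      (Filter.Eventually.of_forall fun s => (hφint s).aestronglyMeasurable) (hφint t)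
      (hmeas t).aestronglyMeasurable (Filter.Eventually.of_forall fun k s _ => hbound s k)
      (hint.norm.const_mul M) (Filter.Eventually.of_forall fun k s _ => hderiv k s)).2
    have h2 : (fun s => ∫ k, φ k ∂(spectralCurve f η s)) =
        fun s => ∫ k, φ (flowMap η s k) ∂spectralMeasure f := by
      ext s
      rw [spectralCurve, integral_map (hflow s).aemeasurable
        hφ.continuous.aestronglyMeasurable]
    rw [h2, spectralCurve, integral_map (hflow t).aemeasurable hvm.aestronglyMeasurable,
      integral_congr_ae hcongr]
    exact h1.hasDerivWithinAt

/-! ### Displacement interpolation of isotropic spectral measures -/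

section Interpolation

variable {d : ℕ}

/-- The radial profile of the map `k + t η_k`, where `θ = t / t₀` and `q` is the profile of the
transport map. -/
noncomputable def interpolatedProfile (q : ℝ → ℝ) (θ r : ℝ) : ℝ := r + θ * (q r - r)

theorem interpolatedProfile_pos {q : ℝ → ℝ} {θ r : ℝ} (hθ : θ ∈ Set.Icc (0 : ℝ) 1) (hr : 0 < r)
    (hq : 0 < q r) : 0 < interpolatedProfile q θ r := by
  have h : interpolatedProfile q θ r = (1 - θ) * r + θ * q r := by
    unfold interpolatedProfile; ring
  rw [h]
  rcases hθ.1.eq_or_lt with rfl | h0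
  · simpa using hr
  · exact add_pos_of_nonneg_of_pos (mul_nonneg (by linarith [hθ.2]) hr.le) (mul_pos h0 hq)

theorem strictMonoOn_interpolatedProfile {q : ℝ → ℝ} {θ : ℝ} {R : Set ℝ}
    (hθ : θ ∈ Set.Icc (0 : ℝ) 1) (hq : StrictMonoOn q R) :
    StrictMonoOn (interpolatedProfile q θ) R := by
  intro r hr s hs hrs
  have h := hq hr hs hrs
  unfold interpolatedProfile
  rcases hθ.1.eq_or_lt with rfl | h0
  · simpa using hrs
  · have h1 := mul_pos h0 (sub_pos.2 h)
    have h2 := mul_nonneg (sub_nonneg.2 hθ.2) (sub_pos.2 hrs).le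
    nlinarith

theorem isotropicField_eq_radialMap {t₀ σ : ℝ} {C C' q : ℝ → ℝ}
    (hq : ∀ r, 0 ≤ r → quantile (radialCDF d σ C') (radialCDF d σ C r) = q r) (k : Freq d) :
    isotropicField d t₀ σ C C' k = (1 / t₀) • (radialMap q k - k) := by
  rw [isotropicField, radialMap, hq _ (norm_nonneg k)]

theorem flowMap_eq_radialMap {t₀ : ℝ} {q : ℝ → ℝ} {η : Freq d → Freq d}
    (hη : ∀ k, η k = (1 / t₀) • (radialMap q k - k)) (t : ℝ) (k : Freq d) :
    flowMap η t k = radialMap (interpolatedProfile q (t / t₀)) k := by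
  rcases eq_or_ne k 0 with rfl | hk
  · simp [flowMap, hη, radialMap]
  have h1 : ‖k‖ ≠ 0 := norm_ne_zero_iff.2 hk
  have h2 : k = ‖k‖ • ((1 / ‖k‖) • k) := by
    rw [smul_smul, mul_one_div_cancel h1, one_smul]
  rw [flowMap, hη]
  simp only [radialMap, interpolatedProfile]
  set e := (1 / ‖k‖) • k with he
  set a := ‖k‖
  rw [h2]
  module

end Interpolation

theorem mainTheorem2 (d : ℕ) (hd : 1 ≤ d) (t₀ : ℝ) (ht₀ : 0 < t₀) (σ : ℝ) (hσ : 0 < σ)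
    (C C' : ℝ → ℝ)
    (hC : IsSpectralDensityOfMass (σ ^ 2) (isotropic d C))
    (hC' : IsSpectralDensityOfMass (σ ^ 2) (isotropic d C'))
    (η : Freq d → Freq d) (hη : η = isotropicField d t₀ σ C C') :
    -- the density and the vector field define a spectral phase model, and `η ∈ L²(C dk)`
    IsSpectralPhaseData (isotropic d C) η ∧
    MemLp η 2 (spectralMeasure (isotropic d C)) ∧
    -- endpoints
    spectralCurve (isotropic d C) η 0 = spectralMeasure (isotropic d C) ∧
    spectralCurve (isotropic d C) η t₀ = spectralMeasure (isotropic d C') ∧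
    -- each measure of the curve is locally attainable
    (∀ t ∈ Set.Icc 0 t₀,
      spectralCurve (isotropic d C) η t ∈ locallyAttainable (isotropic d C) η) ∧
    -- each measure of the curve has a spectral density of mass `σ²` and finite second moment
    (∀ t ∈ Set.Icc 0 t₀, ∃ f : Freq d → ℝ, IsSpectralDensityOfMass (σ ^ 2) f ∧
      spectralCurve (isotropic d C) η t = spectralMeasure f) ∧
    -- the curve is a Wasserstein geodesic
    IsW2Geodesic t₀ (spectralCurve (isotropic d C) η) ∧
    -- `k + t η_k` is the optimal transport from the initial measure to the one at time `t`
    (∀ t ∈ Set.Icc 0 t₀,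
      IsTheOptimalTransport (spectralCurve (isotropic d C) η 0)
        (spectralCurve (isotropic d C) η t) (flowMap η t)) ∧
    -- continuity equation with velocity field `η ∘ T_t⁻¹`
    (∃ S : ℝ → Freq d → Freq d,
      (∀ t ∈ Set.Icc 0 t₀, Measurable (S t) ∧
        ∀ᵐ k ∂(spectralMeasure (isotropic d C)), S t (flowMap η t k) = k) ∧
      SolvesContinuityEq t₀ (spectralCurve (isotropic d C) η) (fun t k => η (S t k))) := by
  have : Nonempty (Fin d) := ⟨⟨0, hd⟩⟩
  have hσ2 : 0 < σ ^ 2 := by positivity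
  set μ := spectralMeasure (isotropic d C) with hμ
  set ν := spectralMeasure (isotropic d C') with hν
  have hμuniv : μ Set.univ = ENNReal.ofReal (σ ^ 2) :=
    hC.mass ▸ spectralMeasure_univ hC.toIsSpectralDensity
  have hνuniv : ν Set.univ = ENNReal.ofReal (σ ^ 2) :=
    hC'.mass ▸ spectralMeasure_univ hC'.toIsSpectralDensity
  have hμfin : IsFiniteMeasure μ := isFiniteMeasure_spectralMeasure hC.toIsSpectralDensity
  have hμac : μ ≪ volume := spectralMeasure_absolutelyContinuous _
  have hνac : ν ≪ volume := spectralMeasure_absolutelyContinuous _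
  set P := normLaw (σ ^ 2) μ with hP
  set P' := normLaw (σ ^ 2) ν with hP'
  have hPprob : IsProbabilityMeasure P := isProbabilityMeasure_normLaw hσ2 hμuniv
  have hP'prob : IsProbabilityMeasure P' := isProbabilityMeasure_normLaw hσ2 hνuniv
  have hPna : NullSingletonClass P := nullSingletonClass_normLaw _ hμac
  have hP'na : NullSingletonClass P' := nullSingletonClass_normLaw _ hνac
  have hP0 : P (Set.Iio 0) = 0 := normLaw_Iio_zero _ _
  have hP'0 : P' (Set.Iio 0) = 0 := normLaw_Iio_zero _ _
  set q := rearrangement P P' with hq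
  set R := regularRadii P P' with hR
  have hqm : Measurable q := measurable_rearrangement
  have hqmono : StrictMonoOn q R := strictMonoOn_rearrangement hP'0
  have hRpos : ∀ r ∈ R, 0 < r := fun r hr => hr.1
  have hRq : ∀ r ∈ R, 0 < q r := fun r hr => hr.2.2.2
  have hc0 : (ENNReal.ofReal (σ ^ 2))⁻¹ ≠ 0 := ENNReal.inv_ne_zero.2 ENNReal.ofReal_ne_top
  have hRae : ∀ᵐ k ∂μ, ‖k‖ ∈ R := by
    have h1 : ∀ᵐ r ∂P, r ∈ R := ae_mem_regularRadii hP0 hP'0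
    rw [hP, normLaw, Measure.ae_ennreal_smul_measure_iff hc0] at h1
    exact ae_of_ae_map measurable_norm.aemeasurable h1
  have hηeq : ∀ k, η k = (1 / t₀) • (radialMap q k - k) := fun k => by
    rw [hη]
    refine isotropicField_eq_radialMap (fun r hr => ?_) k
    rw [quantile_congr fun s hs => radialCDF_eq_cdf_normLaw hd hσ hC' hs,
      radialCDF_eq_cdf_normLaw hd hσ hC hr]
    rfl
  have hqrad : Measurable (radialMap q : Freq d → Freq d) := measurable_radialMap hqm
  have hηm : Measurable η := by
    have : η = fun k => (1 / t₀) • (radialMap q k - k) := funext hηeq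
    rw [this]
    fun_prop
  -- the unit direction is odd and the modulus is even
  have hodd : ∀ k, η (-k) = -η k := fun k => by
    rw [hηeq, hηeq, radialMap, radialMap, norm_neg]
    module
  have hflowm : ∀ t, Measurable (flowMap η t) := fun t => by unfold flowMap; fun_prop
  -- the transport map pushes `μ` forward to `ν`
  have hpush : μ.map (radialMap q) = ν := by
    refine map_radialMap_isotropic hC.integrable.aestronglyMeasurable.aemeasurable
      hC'.integrable.aestronglyMeasurable.aemeasurable hqm (hRae.mono fun k hk => hRpos _ hk) ?_
    have h1 : P.map q = P' := map_rearrangement hP0 hP'0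
    rw [hP, hP', normLaw, normLaw, Measure.map_smul, Measure.map_map hqm measurable_norm] at h1
    have h2 := congrArg (fun M : Measure ℝ => ENNReal.ofReal (σ ^ 2) • M) h1
    simp only [smul_smul, ENNReal.mul_inv_cancel (ENNReal.ofReal_pos.2 hσ2).ne'
      ENNReal.ofReal_ne_top, one_smul] at h2
    exact h2
  have hidμ : MemLp (fun k => k) 2 μ := memLp_id_spectralMeasure hC
  have hqL2 : MemLp (radialMap q) 2 μ := by
    have h1 : MemLp (fun k => k) 2 ν := memLp_id_spectralMeasure hC'
    rw [← hpush] at h1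
    exact (memLp_map_measure_iff (by fun_prop) hqrad.aemeasurable).1 h1
  have hηL2 : MemLp η 2 μ := by
    have : η = (1 / t₀) • (radialMap q - fun k => k) := funext hηeq
    rw [this]
    exact (hqL2.sub hidμ).const_smul _
  have hflowL2 : ∀ t, MemLp (flowMap η t) 2 μ := fun t => hidμ.add (hηL2.const_smul t)
  have hflow2 : ∀ t, ∫⁻ k, ‖flowMap η t k‖ₑ ^ 2 ∂μ ≠ ⊤ := fun t =>
    (memLp_two_iff_lintegral_enorm_sq (hflowm t).aestronglyMeasurable).1 (hflowL2 t)
  have hzero : flowMap η 0 = fun k => k := funext fun k => by simp [flowMap]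
  have hcurve0 : spectralCurve (isotropic d C) η 0 = μ := by
    rw [spectralCurve, hzero]
    exact Measure.map_id
  have hcurve1 : spectralCurve (isotropic d C) η t₀ = ν := by
    have : flowMap η t₀ = radialMap q := funext fun k => by
      rw [flowMap, hηeq, smul_smul, mul_one_div_cancel ht₀.ne', one_smul, add_sub_cancel]
    rw [spectralCurve, this, hpush]
  have hθ : ∀ t ∈ Set.Icc 0 t₀, t / t₀ ∈ Set.Icc (0 : ℝ) 1 := fun t ht =>
    ⟨div_nonneg ht.1 ht₀.le, (div_le_one ht₀).2 ht.2⟩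
  set g : ℝ → ℝ → ℝ := fun t => interpolatedProfile q (t / t₀) with hg
  have hgm : ∀ t, Measurable (g t) := fun t => by
    simp only [hg]
    unfold interpolatedProfile
    fun_prop
  have hgpos : ∀ t ∈ Set.Icc 0 t₀, ∀ r ∈ R, 0 < g t r := fun t ht r hr =>
    interpolatedProfile_pos (hθ t ht) (hRpos r hr) (hRq r hr)
  have hgmono : ∀ t ∈ Set.Icc 0 t₀, StrictMonoOn (g t) R := fun t ht =>
    strictMonoOn_interpolatedProfile (hθ t ht) hqmono
  have hflow : ∀ t k, flowMap η t k = radialMap (g t) k := flowMap_eq_radialMap hηeq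
  have hne : ∀ {k : Freq d}, ‖k‖ ∈ R → k ≠ 0 := fun hk => norm_pos_iff.1 (hRpos _ hk)
  have hnorm : ∀ t ∈ Set.Icc 0 t₀, ∀ k, ‖k‖ ∈ R → ‖flowMap η t k‖ = g t ‖k‖ := fun t ht k hk => by
    rw [hflow, norm_radialMap (hne hk) (hgpos t ht _ hk).le]
  have hdir : ∀ s ∈ Set.Icc 0 t₀, ∀ t ∈ Set.Icc 0 t₀, ∀ᵐ k ∂μ,
      inner ℝ (flowMap η s k) (flowMap η t k) = ‖flowMap η s k‖ * ‖flowMap η t k‖ := by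
    intro s hs t ht
    filter_upwards [hRae] with k hk
    rw [hnorm s hs k hk, hnorm t ht k hk, hflow, hflow, inner_radialMap_radialMap _ _ (hne hk)]
  have hcomono : ∀ s ∈ Set.Icc 0 t₀, ∀ t ∈ Set.Icc 0 t₀,
      AEComonotone μ (fun k => ‖flowMap η s k‖) (fun k => ‖flowMap η t k‖) := by
    refine fun s hs t ht => ⟨{k | ‖k‖ ∈ R}, hRae, fun x hx y hy hxy => ?_⟩
    beta_reduce at hxy ⊢
    rw [hnorm s hs x hx, hnorm s hs y hy] at hxy
    rw [hnorm t ht x hx, hnorm t ht y hy]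
    exact (hgmono t ht).monotoneOn hx hy (((hgmono s hs).lt_iff_lt hx hy).1 hxy).le
  have hW2 : ∀ s ∈ Set.Icc 0 t₀, ∀ t ∈ Set.Icc 0 t₀,
      W2 (spectralCurve (isotropic d C) η s) (spectralCurve (isotropic d C) η t) =
        ENNReal.ofReal |t - s| * (∫⁻ k, ‖η k‖ₑ ^ 2 ∂μ) ^ (1 / 2 : ℝ) := by
    intro s hs t ht
    have h1 : ∀ k, ‖flowMap η s k - flowMap η t k‖ₑ ^ 2 =
        ENNReal.ofReal |t - s| ^ 2 * ‖η k‖ₑ ^ 2 := fun k => by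
      have : flowMap η s k - flowMap η t k = (s - t) • η k := by
        unfold flowMap
        module
      rw [this, enorm_smul, mul_pow, abs_sub_comm, ← Real.enorm_eq_ofReal_abs]
    rw [spectralCurve, spectralCurve, W2_map_eq (hflowm s).aemeasurable (hflowm t).aemeasurable
      (hdir s hs t ht) (hcomono s hs t ht) (hflow2 s) (hflow2 t), lintegral_congr h1,
      lintegral_const_mul' _ _ (ENNReal.pow_ne_top ENNReal.ofReal_ne_top),
      ENNReal.mul_rpow_of_nonneg _ _ (by norm_num), ← ENNReal.rpow_natCast, ← ENNReal.rpow_mul]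
    norm_num
  have h0mem : (0 : ℝ) ∈ Set.Icc 0 t₀ := ⟨le_rfl, ht₀.le⟩
  have h1mem : t₀ ∈ Set.Icc 0 t₀ := ⟨ht₀.le, le_rfl⟩
  -- at `t = t₀` the expansion constant degenerates, but there the density is `C'` itself
  have hac : ∀ t ∈ Set.Icc 0 t₀, spectralCurve (isotropic d C) η t ≪ volume := by
    intro t ht
    rcases ht.2.eq_or_lt with rfl | hlt
    · rw [hcurve1]
      exact hνac
    have hc : 0 < 1 - t / t₀ := sub_pos.2 ((div_lt_one ht₀).2 hlt)
    refine map_absolutelyContinuous_of_expanding hμac (hflowm t) hRae hc fun x hx y hy => ?_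
    have hsplit : ∀ r, g t r - (1 - t / t₀) * r = t / t₀ * q r := fun r => by
      simp only [hg, interpolatedProfile]
      ring
    rw [hflow, hflow]
    refine mul_norm_sub_le_norm_radialMap_sub (hne hx) (hne hy) ?_ ?_ ?_
    · rw [← sub_nonneg, hsplit]
      exact mul_nonneg (hθ t ht).1 (hRq _ hx).le
    · rw [← sub_nonneg, hsplit]
      exact mul_nonneg (hθ t ht).1 (hRq _ hy).le
    · rw [hsplit, hsplit, ← mul_sub, mul_left_comm]
      refine mul_nonneg (hθ t ht).1 ?_
      rcases le_total ‖x‖ ‖y‖ with h | h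
      · exact mul_nonneg_of_nonpos_of_nonpos (sub_nonpos.2 h)
          (sub_nonpos.2 (hqmono.monotoneOn hx hy h))
      · exact mul_nonneg (sub_nonneg.2 h) (sub_nonneg.2 (hqmono.monotoneOn hy hx h))
  have hinv : ∀ t, ∃ S : Freq d → Freq d, t ∈ Set.Icc 0 t₀ →
      Measurable S ∧ ∀ᵐ k ∂μ, S (flowMap η t k) = k := by
    intro t
    by_cases ht : t ∈ Set.Icc 0 t₀
    · have hRm : MeasurableSet {k : Freq d | ‖k‖ ∈ R} :=
        measurable_norm measurableSet_regularRadii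
      have hinj : Set.InjOn (flowMap η t) {k | ‖k‖ ∈ R} := by
        rw [funext (hflow t)]
        exact injOn_radialMap (hgmono t ht) hRpos (hgpos t ht)
      obtain ⟨S, hS⟩ := exists_measurable_ae_leftInverse (hflowm t) hRm hRae hinj
      exact ⟨S, fun _ => hS⟩
    · exact ⟨id, fun h => absurd h ht⟩
  choose S hS using hinv
  refine ⟨⟨hC.toIsSpectralDensity, hηm, hodd⟩, hηL2, hcurve0, hcurve1, fun t _ => ?_,
    fun t ht => ?_, ⟨?_, fun s hs t ht => ?_⟩, fun t ht => ?_, S, hS,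
    solvesContinuityEq_spectralCurve hηm (hηL2.integrable one_le_two) hS⟩
  · -- the scalar matrix `A = t I`
    refine ⟨t • 1, ?_⟩
    rw [spectralCurve]
    congr 1
    ext1 k
    simp [flowMap]
  · have : IsFiniteMeasure (spectralCurve (isotropic d C) η t) := by
      rw [spectralCurve]
      infer_instance
    refine exists_isSpectralDensityOfMass (hac t ht) ?_ hσ2.le ?_ ?_
    · have h1 : (fun k => -k) ∘ flowMap η t = flowMap η t ∘ fun k => -k := by
        ext1 k
        simp only [Function.comp, flowMap, hodd]
        module
      rw [spectralCurve, Measure.map_map measurable_neg (hflowm t), h1,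
        ← Measure.map_map (hflowm t) measurable_neg, map_neg_spectralMeasure hC.even]
    · rw [spectralCurve, Measure.map_apply (hflowm t) .univ]
      exact hμuniv
    · exact (memLp_map_measure_iff (by fun_prop) (hflowm t).aemeasurable).2 (hflowL2 t)
  · rw [hW2 0 h0mem t₀ h1mem]
    exact ENNReal.mul_ne_top ENNReal.ofReal_ne_top (ENNReal.rpow_ne_top_of_nonneg (by norm_num)
      ((memLp_two_iff_lintegral_enorm_sq hηm.aestronglyMeasurable).1 hηL2))
  · rw [hW2 s hs t ht, hW2 0 h0mem t₀ h1mem, ← mul_assoc, ← ENNReal.ofReal_mul (by positivity),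
      sub_zero, abs_of_pos ht₀, div_mul_cancel₀ _ ht₀.ne']
  -- the initial map is the identity, so the coupling `(T_0, T_t)` is the graph of `T_t`
  · rw [hcurve0]
    have hd0 := hdir 0 h0mem t ht
    have hm0 := hcomono 0 h0mem t ht
    rw [hzero] at hd0 hm0
    refine isTheOptimalTransport_of_comonotone (hflowm t) (hgm t)
      (hRae.mono fun k hk => hnorm t ht k hk) (hRae.mono fun k hk => hne hk) hd0 ?_
      (by simpa [hzero] using hflow2 0) (hflow2 t)
    exact ⟨{k | ‖k‖ ∈ R}, hRae, fun x hx y hy hxy => (hgmono t ht).monotoneOn hx hy hxy.le⟩
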